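/- Let $\nu,\alpha,\beta>0$, and let $u_0,f\in H^1(\mathbb R^3;\mathbb R^3)$ be divergence free. For $g\in H^1(\mathbb R^3;\mathbb R^3)$ put $\|g\|^2_{\mathcal H^1_\alpha}=\|g\|^2_{L^2}+\alpha^2\|g\|^2_{\dot H^1}$, where $\|g\|_{\dot H^k}$ is the $L^2$ norm of the tensor of all $k$-th order derivatives of $g$. For $w\in L^2(\mathbb R^3)$ let $(w)_\alpha=(-\alpha^2\Delta+I)^{-1}w$, and let it act on tensors entry by entry. Let $(u,p)$, with $$u\in L^\infty([0,+\infty),H^1(\mathbb R^3))\cap L^2_{loc}([0,+\infty),\dot H^2(\mathbb R^3)),\qquad p\in L^2_{loc}([0,+\infty),H^3(\mathbb R^3)),$$ be a weak (distributional) solution of the damped Navier–Stokes–Bardina problem $$\partial_t u+\operatorname{div}\big((u\otimes u)_\alpha\big)-\nu\Delta u+\nabla p=f-\beta u,\qquad \operatorname{div}u=0,\qquad u(0,\cdot)=u_0 .$$ Then $u$ has a representative in time (again denoted by $u$) which is continuous from $[0,+\infty)$ to $L^2(\mathbb R^3)$, satisfies $u(0,\cdot)=u_0$, and is such that $u(t,\cdot)\in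 H^1(\mathbb R^3)$ is divergence free for every $t\ge 0$. This representative satisfies the following estimates. 1) For all $t\ge 0$: $$\|u(t,\cdot)\|^2_{\mathcal H^1_\alpha}\le \|u_0\|^2_{\mathcal H^1_\alpha}\,e^{-\beta t}+\frac{4}{\beta^2}\|f\|^2_{\mathcal H^1_\alpha}.$$ 2) For all $t\ge 0$ and $T\ge 0$: $$\nu\int_t^{t+T}\|u(s,\cdot)\|^2_{\dot H^1}\,ds+\nu\alpha^2\int_t^{t+T}\|u(s,\cdot)\|^2_{\dot H^2}\,ds\le \frac{2T}{\beta}\|f\|^2_{\mathcal H^1_\alpha}+\|u(t,\cdot)\|^2_{\mathcal H^1_\alpha},$$ where both integrals are finite. If moreover $\nu\ge \tfrac12$, the same inequality also holds with $\alpha^2$ in place of $\nu\alpha^2$ in front of the second integral. -/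

import Mathlib

open MeasureTheory Set
open scoped ContDiff

noncomputable section

namespace Bardina

/-- The physical space `ℝ³` with its Euclidean norm. -/
abbrev E3 : Type := EuclideanSpace ℝ (Fin 3)

/-- Real-valued `L²(ℝ³)`. -/
abbrev L2 : Type := Lp ℝ 2 (volume : Measure E3)

/-- Vector fields in `L²(ℝ³)³`, given by their three components. -/
abbrev VL2 : Type := Fin 3 → L2

/-- Classical partial derivative `∂ⱼ φ`. -/
def pd (j : Fin 3) (φ : E3 → ℝ) (x : E3) : ℝ :=
  fderiv ℝ φ x (EuclideanSpace.single j (1 : ℝ))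

/-- Classical Laplacian `Δ φ = ∑ⱼ ∂ⱼ ∂ⱼ φ`. -/
def lap (φ : E3 → ℝ) (x : E3) : ℝ := ∑ j : Fin 3, pd j (pd j φ) x

/-- Test functions `C_c^∞(ℝ³)`. -/
def IsTest (φ : E3 → ℝ) : Prop := ContDiff ℝ ∞ φ ∧ HasCompactSupport φ

/-- `h = ∂ⱼ g` in the sense of distributions, for `g, h ∈ L²(ℝ³)`. -/
def HasWeakPartial (j : Fin 3) (g h : L2) : Prop :=
  ∀ φ : E3 → ℝ, IsTest φ → ∫ x, g x * pd j φ x = -∫ x, h x * φ x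

open Classical in
/-- The weak partial derivative `∂ⱼ g`, and `0` if `g` has no weak derivative in `L²`. -/
def weakPartial (j : Fin 3) (g : L2) : L2 :=
  if h : ∃ d : L2, HasWeakPartial j g d then h.choose else 0

/-- Membership in the Sobolev space `H^k(ℝ³)`, `k ∈ ℕ`. -/
def MemSob : ℕ → L2 → Prop
  | 0, _ => True
  | k + 1, g => ∀ j : Fin 3, ∃ d : L2, HasWeakPartial j g d ∧ MemSob k d

/-- The homogeneous squared norm
`‖g‖²_{Ḣ^k} = ∑_{j₁, …, j_k} ‖∂_{j₁} ⋯ ∂_{j_k} g‖²_{L²}`, meaningful for `g ∈ H^k`. -/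
def homSq : ℕ → L2 → ℝ
  | 0, g => ‖g‖ ^ 2
  | k + 1, g => ∑ j : Fin 3, homSq k (weakPartial j g)

/-- Squared `Ḣ^k` norm of a vector field. -/
def vhomSq (k : ℕ) (u : VL2) : ℝ := ∑ i : Fin 3, homSq k (u i)

/-- `‖u‖²_{𝓗¹_α} = ‖u‖²_{L²} + α² ‖u‖²_{Ḣ¹}`. -/
def energySq (α : ℝ) (u : VL2) : ℝ := vhomSq 0 u + α ^ 2 * vhomSq 1 u

/-- `div u = 0` in the sense of distributions. -/
def IsDivFree (u : VL2) : Prop :=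
  ∀ φ : E3 → ℝ, IsTest φ → ∫ x, ∑ i : Fin 3, u i x * pd i φ x = 0

/-- Divergence-free vector fields in `H¹(ℝ³)`; this is the set underlying `𝓗¹_α(ℝ³)`. -/
def MemSolenoidalH1 (u : VL2) : Prop := (∀ i, MemSob 1 (u i)) ∧ IsDivFree u

/-- `w = (g)_α = (-α² Δ + I)⁻¹ g`: the function `w ∈ L²(ℝ³)` solves the Helmholtz equation
`-α² Δ w + w = g` in the sense of distributions. -/
def IsHelmholtzFilter (α : ℝ) (g : E3 → ℝ) (w : L2) : Prop :=
  ∀ φ : E3 → ℝ, IsTest φ →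
    ∫ x, w x * (φ x - α ^ 2 * lap φ x) = ∫ x, g x * φ x

/-- Lebesgue measure on the time interval `[0, +∞)`. -/
def timeMeasure : Measure ℝ := volume.restrict (Ici 0)

/-- `u ∈ L^∞([0,+∞), H¹) ∩ L²_loc([0,+∞), Ḣ²)`. -/
structure InEnergySpace (u : ℝ → VL2) : Prop where
  meas : AEStronglyMeasurable u timeMeasure
  memH1 : ∀ᵐ t ∂timeMeasure, ∀ i, MemSob 1 (u t i)
  bound : ∃ M : ℝ, ∀ᵐ t ∂timeMeasure, vhomSq 0 (u t) + vhomSq 1 (u t) ≤ M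
  memH2 : ∀ᵐ t ∂timeMeasure, ∀ i, MemSob 2 (u t i)
  sqInt : ∀ T : ℝ, IntegrableOn (fun t => vhomSq 2 (u t)) (Icc 0 T)

/-- `p ∈ L²_loc([0,+∞), H³)`. -/
structure InPressureSpace (p : ℝ → L2) : Prop where
  meas : AEStronglyMeasurable p timeMeasure
  memH3 : ∀ᵐ t ∂timeMeasure, MemSob 3 (p t)
  sqInt : ∀ T : ℝ, IntegrableOn (fun t => ∑ k ∈ Finset.range 4, homSq k (p t)) (Icc 0 T)

/-- `(u, p)` is a weak solution, in the energy space, of the damped Navier-Stokes-Bardina problem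
`∂ₜ u + div ((u ⊗ u)_α) - ν Δ u + ∇ p = f - β u`, `div u = 0`, `u(0, ·) = u₀`.
The equation and the initial condition are tested, component by component, against smooth
functions that are compactly supported in `[0, +∞) × ℝ³` (restrictions of elements of
`C_c^∞(ℝ × ℝ³)`). -/
structure IsWeakSolution (ν α β : ℝ) (f u₀ : VL2) (u : ℝ → VL2) (p : ℝ → L2) : Prop where
  energySpace : InEnergySpace u
  pressureSpace : InPressureSpace p
  divFree : ∀ᵐ t ∂timeMeasure, IsDivFree (u t)
  equation : ∃ w : ℝ → Fin 3 → Fin 3 → L2,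
    (∀ᵐ t ∂timeMeasure, ∀ i j,
      IsHelmholtzFilter α (fun x => u t i x * u t j x) (w t i j)) ∧
    ∀ (i : Fin 3) (φ : ℝ × E3 → ℝ), ContDiff ℝ ∞ φ → HasCompactSupport φ →
      (∫ t, (∫ x,
          (u t i x * deriv (fun s => φ (s, x)) t
            + ∑ j : Fin 3, w t i j x * pd j (fun y => φ (t, y)) x
            + ν * (u t i x * lap (fun y => φ (t, y)) x)
            + p t x * pd i (fun y => φ (t, y)) x
            + f i x * φ (t, x)
            - β * (u t i x * φ (t, x)))) ∂timeMeasure)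
        + ∫ x, u₀ i x * φ (0, x) = 0

/-- `v` is the representative of the time-a.e. class of `u` that is continuous on `[0, +∞)`
with values in `L²`; it gives `u(t, ·)` its meaning for every single `t ≥ 0`. -/
def IsContinuousVersion (u v : ℝ → VL2) : Prop :=
  ContinuousOn v (Ici 0) ∧ ∀ᵐ t ∂timeMeasure, v t = u t

end Bardina

end

noncomputable section

namespace Bardina

open Filter Topology

/-! Formally, pair the equation with `u - α²Δu`. Since `1 - α²Δ` undoes the filter, the nonlinear
term becomes the usual trilinear form `∫ (u·∇u)·u`, which vanishes for divergence-free `u`. The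
pressure term vanishes because both `u` and `Δu` are divergence free. What remains is `½ dE/dt =
-ν(‖u‖²_{Ḣ¹} + α²‖u‖²_{Ḣ²}) - βE + (f,u)_{𝓗¹_α}`, with `E` the squared `𝓗¹_α` norm. Young's
inequality with weight `β` gives `E' + βE + 2νD ≤ ‖f‖²/β`, with `D` the dissipation. Gronwall's
inequality (`le_exp_of_integral_le`) yields the first estimate, and direct integration yields the
second.

Two points need rigour. The first is the meaning of `∂ₜu`. Sobolev embedding puts `u ⊗ u` in `L²`
(`exists_norm_mul_le`), so the filtered divergence is an `L²` function (`exists_filtered_div`).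
Testing only with `θ(t)(φ - α²Δφ)` removes the filter, and it loses nothing because these spatial
functions are dense in `L²` (`dense_range_testHelm`). Hence `u` agrees almost everywhere with `u₀ +
∫₀ᵗ G`, where `G` is locally square integrable with values in `L²` (`exists_force`,
`ae_eq_prim_of_weak`). This primitive is the continuous representative, and uniform `H¹` bounds
extend to every time by closedness.

The second is the chain rule for `E`: `G` has no spatial derivative, so `⟨∇G, ∇u⟩` is undefined. The
energy is computed after mollification in space, the derivative on `G` is moved to `u ∈ H²`, and the
mollification is removed by dominated convergence (`InEnergySpace.energySq_prim_sub`). -/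

instance fact_two_ne_top : Fact ((2 : ENNReal) ≠ ⊤) := ⟨ENNReal.ofNat_ne_top⟩

/-! ### Test functions -/

namespace IsTest

variable {φ ψ : E3 → ℝ}

theorem continuous (hφ : IsTest φ) : Continuous φ := hφ.1.continuous

theorem differentiable (hφ : IsTest φ) : Differentiable ℝ φ := hφ.1.differentiable (by simp)

theorem memLp (hφ : IsTest φ) {p : ENNReal} : MemLp φ p (volume : Measure E3) :=
  hφ.continuous.memLp_of_hasCompactSupport hφ.2

theorem integrable (hφ : IsTest φ) : Integrable φ :=
  hφ.continuous.integrable_of_hasCompactSupport hφ.2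

theorem pd (hφ : IsTest φ) (j : Fin 3) : IsTest (pd j φ) := by
  refine ⟨?_, ?_⟩
  · have h : ContDiff ℝ ∞ (fderiv ℝ φ) := hφ.1.fderiv_right (m := ∞) (by simp)
    exact h.clm_apply contDiff_const
  · exact hφ.2.fderiv_apply ℝ _

theorem add (hφ : IsTest φ) (hψ : IsTest ψ) : IsTest (fun x => φ x + ψ x) :=
  ⟨hφ.1.add hψ.1, hφ.2.add hψ.2⟩

theorem const_mul (hφ : IsTest φ) (c : ℝ) : IsTest (fun x => c * φ x) :=
  ⟨contDiff_const.mul hφ.1, hφ.2.mul_left⟩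

theorem sub (hφ : IsTest φ) (hψ : IsTest ψ) : IsTest (fun x => φ x - ψ x) :=
  ⟨hφ.1.sub hψ.1, by
    have h : (fun x => φ x - ψ x) = φ + fun x => -ψ x := by
      funext x; simp [sub_eq_add_neg]
    rw [h]
    exact hφ.2.add (HasCompactSupport.neg hψ.2)⟩

theorem mul (hφ : IsTest φ) (hψ : IsTest ψ) : IsTest (fun x => φ x * ψ x) :=
  ⟨hφ.1.mul hψ.1, hφ.2.mul_right⟩

theorem lap (hφ : IsTest φ) : IsTest (lap φ) := by
  have h : Bardina.lap φ = fun x => Bardina.pd 0 (Bardina.pd 0 φ) x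
      + Bardina.pd 1 (Bardina.pd 1 φ) x + Bardina.pd 2 (Bardina.pd 2 φ) x := by
    funext x; simp [Bardina.lap, Fin.sum_univ_three]
  rw [h]
  exact (((hφ.pd 0).pd 0).add ((hφ.pd 1).pd 1)).add ((hφ.pd 2).pd 2)

theorem comp_sub (hφ : IsTest φ) (z : E3) : IsTest (fun x => φ (x - z)) :=
  ⟨hφ.1.comp (contDiff_id.sub contDiff_const),
    hφ.2.comp_homeomorph (Homeomorph.subRight z)⟩

/-- A test function as an element of `L²`. -/
def toL2 (hφ : IsTest φ) : L2 := hφ.memLp.toLp φ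

theorem coeFn_toL2 (hφ : IsTest φ) : (hφ.toL2 : E3 → ℝ) =ᵐ[volume] φ := hφ.memLp.coeFn_toLp

end IsTest

theorem pd_add {φ ψ : E3 → ℝ} (hφ : IsTest φ) (hψ : IsTest ψ) (j : Fin 3) :
    pd j (fun x => φ x + ψ x) = fun x => pd j φ x + pd j ψ x := by
  funext x
  simp only [pd]
  rw [fderiv_fun_add (hφ.differentiable x) (hψ.differentiable x)]
  rfl

theorem pd_sub {φ ψ : E3 → ℝ} (hφ : IsTest φ) (hψ : IsTest ψ) (j : Fin 3) :
    pd j (fun x => φ x - ψ x) = fun x => pd j φ x - pd j ψ x := by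
  funext x
  simp only [pd]
  rw [fderiv_fun_sub (hφ.differentiable x) (hψ.differentiable x)]
  rfl

theorem pd_const_mul {φ : E3 → ℝ} (hφ : IsTest φ) (c : ℝ) (j : Fin 3) :
    pd j (fun x => c * φ x) = fun x => c * pd j φ x := by
  funext x
  simp only [pd]
  rw [fderiv_const_mul (hφ.differentiable x)]
  rfl

theorem pd_mul {φ ψ : E3 → ℝ} (hφ : IsTest φ) (hψ : IsTest ψ) (j : Fin 3) :
    pd j (fun x => φ x * ψ x) = fun x => φ x * pd j ψ x + ψ x * pd j φ x := by
  funext x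
  simp only [pd]
  rw [fderiv_fun_mul (hφ.differentiable x) (hψ.differentiable x)]
  rfl

theorem pd_comm {φ : E3 → ℝ} (hφ : IsTest φ) (j k : Fin 3) :
    pd j (pd k φ) = pd k (pd j φ) := by
  funext x
  have hd : DifferentiableAt ℝ (fderiv ℝ φ) x :=
    (hφ.1.fderiv_right (m := ∞) (by simp)).differentiable (by simp) x
  have hs : IsSymmSndFDerivAt ℝ φ x :=
    hφ.1.contDiffAt.isSymmSndFDerivAt (by
      rw [minSmoothness_of_isRCLikeNormedField]; exact WithTop.coe_le_coe.2 (le_top : (2 : ℕ∞) ≤ ⊤))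
  have key : ∀ a b : E3, fderiv ℝ (fun y => fderiv ℝ φ y a) x b = fderiv ℝ (fderiv ℝ φ) x b a := by
    intro a b
    rw [fderiv_clm_apply hd (differentiableAt_const a)]
    simp
  change fderiv ℝ (fun y => fderiv ℝ φ y _) x _ = fderiv ℝ (fun y => fderiv ℝ φ y _) x _
  rw [key, key]
  exact hs _ _

theorem lap_pd {φ : E3 → ℝ} (hφ : IsTest φ) (j : Fin 3) : lap (pd j φ) = pd j (lap φ) := by
  have h : ∀ ψ : E3 → ℝ, lap ψ = fun x => pd 0 (pd 0 ψ) x + pd 1 (pd 1 ψ) x + pd 2 (pd 2 ψ) x := by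
    intro ψ; funext x; simp [lap, Fin.sum_univ_three]
  have hk : ∀ k, pd k (pd k (pd j φ)) = pd j (pd k (pd k φ)) := fun k => by
    rw [pd_comm hφ k j, pd_comm (hφ.pd k) k j]
  rw [h φ, h (pd j φ), pd_add (((hφ.pd 0).pd 0).add ((hφ.pd 1).pd 1)) ((hφ.pd 2).pd 2),
    pd_add ((hφ.pd 0).pd 0) ((hφ.pd 1).pd 1), hk, hk, hk]

theorem pd_comp_sub {φ : E3 → ℝ} (z : E3) (j : Fin 3) :
    pd j (fun x => φ (x - z)) = fun x => pd j φ (x - z) := by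
  funext x
  simp only [pd]
  rw [fderiv_comp_sub]

/-! ### Pairing with test functions -/

theorem inner_eq_integral (g h : L2) : inner ℝ g h = ∫ x, g x * h x := by
  rw [L2.inner_def]
  exact integral_congr_ae (Eventually.of_forall fun x => by simp [mul_comm])

theorem inner_toL2 (g : L2) {φ : E3 → ℝ} (hφ : IsTest φ) :
    inner ℝ g hφ.toL2 = ∫ x, g x * φ x := by
  rw [inner_eq_integral]
  refine integral_congr_ae ?_
  filter_upwards [hφ.coeFn_toL2] with x hx
  rw [hx]

theorem integrable_mul_test (g : L2) {φ : E3 → ℝ} (hφ : IsTest φ) :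
    Integrable (fun x => g x * φ x) :=
  (Lp.memLp g).integrable_mul (hφ.memLp (p := 2))

/-- In inner-product form, weak differentiability is a family of continuous linear conditions on the
pair, from which linearity, uniqueness and closedness follow. -/
theorem hasWeakPartial_iff {j : Fin 3} {g h : L2} :
    HasWeakPartial j g h ↔ ∀ (φ : E3 → ℝ) (hφ : IsTest φ),
      inner ℝ g (hφ.pd j).toL2 = -inner ℝ h hφ.toL2 := by
  refine forall_congr' fun φ => forall_congr' fun hφ => ?_
  rw [inner_toL2, inner_toL2]

theorem toL2_congr {φ ψ : E3 → ℝ} (hφ : IsTest φ) (hψ : IsTest ψ) (h : φ = ψ) :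
    hφ.toL2 = hψ.toL2 := by subst h; rfl

theorem toL2_add {φ ψ : E3 → ℝ} (hφ : IsTest φ) (hψ : IsTest ψ) :
    (hφ.add hψ).toL2 = hφ.toL2 + hψ.toL2 := rfl

theorem toL2_sub {φ ψ : E3 → ℝ} (hφ : IsTest φ) (hψ : IsTest ψ) :
    (hφ.sub hψ).toL2 = hφ.toL2 - hψ.toL2 := rfl

theorem toL2_const_mul {φ : E3 → ℝ} (hφ : IsTest φ) (c : ℝ) :
    (hφ.const_mul c).toL2 = c • hφ.toL2 := rfl

/-- The set of test functions in `L²`. -/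
def testSet : Set L2 := {g | ∃ (φ : E3 → ℝ) (hφ : IsTest φ), hφ.toL2 = g}

theorem dense_testSet : Dense testSet := by
  refine (Lp.dense_hasCompactSupport_contDiff (E := E3) (F := ℝ) (μ := volume)
    (p := 2) ENNReal.ofNat_ne_top).mono ?_
  rintro f ⟨g, hfg, hg, hg'⟩
  exact ⟨g, ⟨hg', hg⟩, Lp.ext ((IsTest.coeFn_toL2 ⟨hg', hg⟩).trans hfg.symm)⟩

theorem eq_of_inner_test {g h : L2}
    (H : ∀ (φ : E3 → ℝ) (hφ : IsTest φ), inner ℝ g hφ.toL2 = inner ℝ h hφ.toL2) : g = h := by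
  have : (fun k : L2 => inner ℝ g k) = fun k => inner ℝ h k := by
    refine Continuous.ext_on dense_testSet (by fun_prop) (by fun_prop) ?_
    rintro _ ⟨φ, hφ, rfl⟩
    exact H φ hφ
  exact ext_inner_right ℝ fun k => congrFun this k

/-! ### Weak derivatives -/

namespace HasWeakPartial

variable {j k : Fin 3} {g h d e : L2}

theorem unique (h₁ : HasWeakPartial j g d) (h₂ : HasWeakPartial j g e) : d = e :=
  eq_of_inner_test fun φ hφ => by
    have a := hasWeakPartial_iff.1 h₁ φ hφ
    have b := hasWeakPartial_iff.1 h₂ φ hφ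
    linarith

theorem weakPartial_eq (h : HasWeakPartial j g d) : weakPartial j g = d := by
  have hex : ∃ d : L2, HasWeakPartial j g d := ⟨d, h⟩
  rw [weakPartial, dif_pos hex]
  exact hex.choose_spec.unique h

theorem add (h₁ : HasWeakPartial j g d) (h₂ : HasWeakPartial j h e) :
    HasWeakPartial j (g + h) (d + e) := hasWeakPartial_iff.2 fun φ hφ => by
  rw [inner_add_left, inner_add_left, hasWeakPartial_iff.1 h₁ φ hφ,
    hasWeakPartial_iff.1 h₂ φ hφ]; ring

theorem smul (h₁ : HasWeakPartial j g d) (c : ℝ) :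
    HasWeakPartial j (c • g) (c • d) := hasWeakPartial_iff.2 fun φ hφ => by
  rw [real_inner_smul_left, real_inner_smul_left, hasWeakPartial_iff.1 h₁ φ hφ]; ring

theorem sub (h₁ : HasWeakPartial j g d) (h₂ : HasWeakPartial j h e) :
    HasWeakPartial j (g - h) (d - e) := by
  simpa [sub_eq_add_neg] using h₁.add (h₂.smul (-1))

end HasWeakPartial

theorem isClosed_hasWeakPartial (j : Fin 3) :
    IsClosed {q : L2 × L2 | HasWeakPartial j q.1 q.2} := by
  have : {q : L2 × L2 | HasWeakPartial j q.1 q.2} = ⋂ (φ : E3 → ℝ) (hφ : IsTest φ),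
      {q : L2 × L2 | inner ℝ q.1 (hφ.pd j).toL2 = -inner ℝ q.2 hφ.toL2} := by
    ext q; simp [hasWeakPartial_iff]
  rw [this]
  exact isClosed_iInter fun φ => isClosed_iInter fun hφ =>
    isClosed_eq (by fun_prop) (by fun_prop)

theorem IsTest.hasWeakPartial {φ : E3 → ℝ} (hφ : IsTest φ) (j : Fin 3) :
    HasWeakPartial j hφ.toL2 (hφ.pd j).toL2 := by
  refine hasWeakPartial_iff.2 fun ψ hψ => ?_
  have e1 : inner ℝ hφ.toL2 (hψ.pd j).toL2 = ∫ x, φ x * Bardina.pd j ψ x := by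
    rw [inner_toL2]
    exact integral_congr_ae (by filter_upwards [hφ.coeFn_toL2] with x hx; rw [hx])
  have e2 : inner ℝ (hφ.pd j).toL2 hψ.toL2 = ∫ x, Bardina.pd j φ x * ψ x := by
    rw [inner_toL2]
    exact integral_congr_ae (by filter_upwards [(hφ.pd j).coeFn_toL2] with x hx; rw [hx])
  rw [e1, e2]
  exact integral_mul_fderiv_eq_neg_fderiv_mul_of_integrable ((hφ.pd j).mul hψ).integrable
    (hφ.mul (hψ.pd j)).integrable (hφ.mul hψ).integrable
    (fun x _ => hφ.differentiable x) (fun x _ => hψ.differentiable x)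

/-! ### Translations and mollification -/

/-- The translate `x ↦ g (x - z)`. -/
def trans (z : E3) (g : L2) : L2 := DomAddAct.mk (-z) +ᵥ g

theorem coeFn_trans (z : E3) (g : L2) : (trans z g : E3 → ℝ) =ᵐ[volume] fun x => g (x - z) := by
  filter_upwards [DomAddAct.vadd_Lp_ae_eq (DomAddAct.mk (-z)) g] with x hx
  rw [trans, hx]
  simp [sub_eq_neg_add]

theorem norm_trans (z : E3) (g : L2) : ‖trans z g‖ = ‖g‖ := DomAddAct.norm_vadd_Lp _ _

theorem trans_add (z : E3) (g h : L2) : trans z (g + h) = trans z g + trans z h :=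
  DomAddAct.vadd_Lp_add _ _ _

theorem trans_smul (z : E3) (c : ℝ) (g : L2) : trans z (c • g) = c • trans z g := by
  refine Lp.ext ?_
  have h1 : ∀ᵐ x, (c • g : L2) (x - z) = (c • (g : E3 → ℝ)) (x - z) :=
    (measurePreserving_sub_right volume z).quasiMeasurePreserving.ae
      (Lp.coeFn_smul c g)
  filter_upwards [coeFn_trans z (c • g), coeFn_trans z g, Lp.coeFn_smul c (trans z g), h1]
    with x a b d e
  rw [a, d, e, Pi.smul_apply, Pi.smul_apply, b]

theorem trans_zero (g : L2) : trans 0 g = g := by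
  refine Lp.ext ?_
  filter_upwards [coeFn_trans 0 g] with x hx
  rw [hx, sub_zero]

theorem continuous_trans (g : L2) : Continuous fun z => trans z g := by
  -- Strong continuity of translations needs a finite exponent; `fact_two_ne_top` supplies it.
  have hc : ContinuousVAdd E3ᵈᵃᵃ L2 := inferInstance
  unfold trans
  exact (DomAddAct.continuous_mk.comp continuous_neg).vadd continuous_const

theorem inner_trans_toL2 (z : E3) {ψ χ : E3 → ℝ} (hψ : IsTest ψ) (hχ : IsTest χ) :
    inner ℝ (trans z hψ.toL2) hχ.toL2 = ∫ x, ψ (x - z) * χ x := by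
  rw [inner_toL2]
  have h1 : ∀ᵐ x, hψ.toL2 (x - z) = ψ (x - z) :=
    (measurePreserving_sub_right volume z).quasiMeasurePreserving.ae hψ.coeFn_toL2
  refine integral_congr_ae ?_
  filter_upwards [h1, coeFn_trans z hψ.toL2] with x a b
  rw [b, a]

theorem integrable_smul_trans {k : E3 → ℝ} (hk : IsTest k) (g : L2) :
    Integrable (fun z => k z • trans z g) :=
  (hk.continuous.smul (continuous_trans g)).integrable_of_hasCompactSupport hk.2.smul_right

/-- Mollification `k ∗ g` of `g ∈ L²` by a test function `k`. -/
def moll {k : E3 → ℝ} (hk : IsTest k) : L2 →L[ℝ] L2 :=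
  LinearMap.mkContinuous
    { toFun := fun g => ∫ z, k z • trans z g
      map_add' := fun g h => by
        rw [← integral_add (integrable_smul_trans hk g) (integrable_smul_trans hk h)]
        simp only [trans_add, smul_add]
      map_smul' := fun c g => by
        rw [RingHom.id_apply, ← integral_smul]
        simp only [trans_smul, smul_comm c] }
    (∫ z, |k z|) fun g => by
      refine (norm_integral_le_integral_norm _).trans (le_of_eq ?_)
      rw [← integral_mul_const]
      simp [norm_smul, norm_trans]

theorem moll_apply {k : E3 → ℝ} (hk : IsTest k) (g : L2) :
    moll hk g = ∫ z, k z • trans z g := rfl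

theorem norm_moll_le {k : E3 → ℝ} (hk : IsTest k) (g : L2) :
    ‖moll hk g‖ ≤ (∫ z, |k z|) * ‖g‖ := by
  rw [moll_apply]
  refine (norm_integral_le_integral_norm _).trans (le_of_eq ?_)
  rw [← integral_mul_const]
  simp [norm_smul, norm_trans]

theorem inner_moll {k : E3 → ℝ} (hk : IsTest k) (g h : L2) :
    inner ℝ (moll hk g) h = ∫ z, k z * inner ℝ (trans z g) h := by
  rw [real_inner_comm, moll_apply, ← integral_inner (integrable_smul_trans hk g)]
  simp only [real_inner_smul_right]
  exact integral_congr_ae (Eventually.of_forall fun z => by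
    simp only []; rw [real_inner_comm])

theorem HasWeakPartial.trans {j : Fin 3} {g d : L2} (h : HasWeakPartial j g d) (z : E3) :
    HasWeakPartial j (trans z g) (trans z d) := by
  intro φ hφ
  have key : ∀ (a : L2) (χ : E3 → ℝ), ∫ x, Bardina.trans z a x * χ x
      = ∫ x, a x * χ (x - -z) := by
    intro a χ
    rw [← integral_sub_right_eq_self (fun x => a x * χ (x - -z)) z]
    refine integral_congr_ae ?_
    filter_upwards [coeFn_trans z a] with x hx
    rw [hx]; simp
  rw [key, key]
  have := h _ (hφ.comp_sub (-z))
  rwa [pd_comp_sub] at this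

theorem HasWeakPartial.moll {j : Fin 3} {g d : L2} (h : HasWeakPartial j g d)
    {k : E3 → ℝ} (hk : IsTest k) : HasWeakPartial j (moll hk g) (moll hk d) := by
  refine hasWeakPartial_iff.2 fun φ hφ => ?_
  rw [inner_moll, inner_moll, ← integral_neg]
  refine integral_congr_ae (Eventually.of_forall fun z => ?_)
  simp only []
  rw [hasWeakPartial_iff.1 (h.trans z) φ hφ]
  ring

/-- Convolution of two test functions. -/
def conv (k ψ : E3 → ℝ) : E3 → ℝ :=
  convolution k ψ (ContinuousLinearMap.mul ℝ ℝ) volume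

theorem conv_apply (k ψ : E3 → ℝ) (x : E3) : conv k ψ x = ∫ z, k z * ψ (x - z) := rfl

theorem conv_comm (k ψ : E3 → ℝ) : conv k ψ = conv ψ k := by
  unfold conv
  rw [← convolution_flip]
  congr 1
  ext; simp

theorem IsTest.conv {k ψ : E3 → ℝ} (hk : IsTest k) (hψ : IsTest ψ) : IsTest (conv k ψ) :=
  ⟨hψ.2.contDiff_convolution_right _ hk.integrable.locallyIntegrable hψ.1,
    HasCompactSupport.convolution _ hk.2 hψ.2⟩

theorem pd_conv {k ψ : E3 → ℝ} (hk : IsTest k) (hψ : IsTest ψ) (j : Fin 3) :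
    pd j (conv k ψ) = conv k (pd j ψ) := by
  funext x
  have h1 : ContDiff ℝ 1 ψ := hψ.1.of_le (by simp)
  have h := (hψ.2.hasFDerivAt_convolution_right (ContinuousLinearMap.mul ℝ ℝ)
    hk.integrable.locallyIntegrable h1 x).fderiv
  unfold pd conv
  rw [h, convolution_precompR_apply _ hk.integrable.locallyIntegrable (hψ.2.fderiv ℝ)
    (h1.continuous_fderiv (by simp))]

theorem pd_conv_left {k ψ : E3 → ℝ} (hk : IsTest k) (hψ : IsTest ψ) (j : Fin 3) :
    pd j (conv k ψ) = conv (pd j k) ψ := by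
  rw [conv_comm, pd_conv hψ hk, conv_comm]

/-- Fubini against a third test function. This keeps mollified test functions inside the class of
test functions, so density arguments can return to it. -/
theorem moll_toL2 {k ψ : E3 → ℝ} (hk : IsTest k) (hψ : IsTest ψ) :
    moll hk hψ.toL2 = (hk.conv hψ).toL2 := by
  refine eq_of_inner_test fun χ hχ => ?_
  rw [inner_moll]
  have e1 : inner ℝ (hk.conv hψ).toL2 hχ.toL2 = ∫ x, conv k ψ x * χ x := by
    rw [inner_toL2]
    exact integral_congr_ae (by filter_upwards [(hk.conv hψ).coeFn_toL2] with x hx; rw [hx])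
  rw [e1]
  simp only [inner_trans_toL2, conv_apply, ← integral_const_mul, ← integral_mul_const]
  rw [integral_integral_swap_of_hasCompactSupport]
  · simp only [mul_assoc]
  · have := hk.continuous; have := hψ.continuous; have := hχ.continuous
    unfold Function.uncurry
    fun_prop
  · refine HasCompactSupport.intro (hk.2.isCompact.prod hχ.2.isCompact) ?_
    rintro ⟨z, x⟩ hzx
    rw [Set.mem_prod, not_and_or] at hzx
    rcases hzx with h | h
    · simp [Function.uncurry, image_eq_zero_of_notMem_tsupport h]
    · simp [Function.uncurry, image_eq_zero_of_notMem_tsupport h]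

/-- The derivative falls on the kernel, so `g` needs no regularity: the identity is classical for
test functions and extends by density, because the graph of the weak derivative is closed. -/
theorem hasWeakPartial_moll {k : E3 → ℝ} (hk : IsTest k) (j : Fin 3) (g : L2) :
    HasWeakPartial j (moll hk g) (moll (hk.pd j) g) := by
  have hc : IsClosed {g : L2 | HasWeakPartial j (moll hk g) (moll (hk.pd j) g)} :=
    (isClosed_hasWeakPartial j).preimage
      (f := fun g : L2 => (moll hk g, moll (hk.pd j) g)) (by fun_prop)
  refine hc.closure_subset_iff.2 ?_ (dense_testSet g)
  rintro _ ⟨ψ, hψ, rfl⟩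
  simp only [mem_ofPred_eq, moll_toL2]
  have := (hk.conv hψ).hasWeakPartial j
  rwa [toL2_congr ((hk.conv hψ).pd j) ((hk.pd j).conv hψ) (pd_conv_left hk hψ j)] at this

/-! ### An approximate identity -/

/-- A smooth bump supported in a ball of radius `1 / (n + 1)`. -/
def bump (n : ℕ) : ContDiffBump (0 : E3) where
  rIn := 1 / (n + 2)
  rOut := 1 / (n + 1)
  rIn_pos := by positivity
  rIn_lt_rOut := by
    apply one_div_lt_one_div_of_lt <;> [positivity; linarith]

/-- The mollifying kernels. -/
def ker (n : ℕ) : E3 → ℝ := (bump n).normed volume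

theorem isTest_ker (n : ℕ) : IsTest (ker n) :=
  ⟨(bump n).contDiff_normed, (bump n).hasCompactSupport_normed⟩

/-- The smoothing operators `g ↦ ρₙ ∗ g`. -/
def smooth (n : ℕ) : L2 →L[ℝ] L2 := moll (isTest_ker n)

/-- The operators `g ↦ ∂ⱼ ρₙ ∗ g = ∂ⱼ (ρₙ ∗ g)`. -/
def dsmooth (n : ℕ) (j : Fin 3) : L2 →L[ℝ] L2 := moll ((isTest_ker n).pd j)

theorem norm_smooth_le (n : ℕ) (g : L2) : ‖smooth n g‖ ≤ ‖g‖ := by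
  have h := norm_moll_le (isTest_ker n) g
  have h1 : ∫ z, |ker n z| = 1 := by
    simp only [ker, abs_of_nonneg ((bump n).nonneg_normed _)]
    exact (bump n).integral_normed
  rwa [h1, one_mul] at h

theorem tendsto_smooth (g : L2) : Tendsto (fun n => smooth n g) atTop (𝓝 g) := by
  -- The mollified function is the value at `0` of the convolution of the kernel with the continuous
  -- `L²`-valued map `z ↦ trans (-z) g`.
  have h := ContDiffBump.convolution_tendsto_right_of_continuous (μ := (volume : Measure E3))
    (φ := bump) (l := atTop) (g := fun z => trans (-z) g)
    (by simpa [bump] using tendsto_one_div_add_atTop_nhds_zero_nat (𝕜 := ℝ))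
    ((continuous_trans g).comp continuous_neg) 0
  simp only [convolution_def, zero_sub, neg_neg, neg_zero, trans_zero] at h
  exact h

theorem hasWeakPartial_smooth (n : ℕ) (j : Fin 3) (g : L2) :
    HasWeakPartial j (smooth n g) (dsmooth n j g) := hasWeakPartial_moll _ j g

theorem HasWeakPartial.smooth {j : Fin 3} {g d : L2} (h : HasWeakPartial j g d) (n : ℕ) :
    HasWeakPartial j (smooth n g) (smooth n d) := h.moll _

/-- Both sides are the weak derivative of the same mollified function. This lets a derivative be
traded between the kernel and `g`, and gives convergence of `dsmooth n j g`. -/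
theorem HasWeakPartial.dsmooth_eq {j : Fin 3} {g d : L2} (h : HasWeakPartial j g d) (n : ℕ) :
    dsmooth n j g = Bardina.smooth n d :=
  (hasWeakPartial_smooth n j g).unique (h.smooth n)

theorem tendsto_smooth_smooth (g : L2) :
    Tendsto (fun n => smooth n (smooth n g)) atTop (𝓝 g) := by
  have h : Tendsto (fun n => smooth n (smooth n g - g) + smooth n g) atTop (𝓝 (0 + g)) := by
    refine Tendsto.add ?_ (tendsto_smooth g)
    refine squeeze_zero_norm (fun n => norm_smooth_le n _) ?_
    have := (tendsto_smooth g).sub_const g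
    simpa using this.norm
  simpa using h

/-! ### Density of test functions in Sobolev spaces -/

/-- Test functions are dense in `H²`, with respect to the function, its gradient and its pure
second derivatives. -/
theorem mem_closure_test_sobolev_two {g : L2} {d e : Fin 3 → L2}
    (hd : ∀ j, HasWeakPartial j g (d j)) (he : ∀ j, HasWeakPartial j (d j) (e j)) :
    (g, d, e) ∈ closure {q : L2 × (Fin 3 → L2) × (Fin 3 → L2) | ∃ (φ : E3 → ℝ) (hφ : IsTest φ),
      q = (hφ.toL2, fun j => (hφ.pd j).toL2, fun j => ((hφ.pd j).pd j).toL2)} := by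
  set Q := {q : L2 × (Fin 3 → L2) × (Fin 3 → L2) | ∃ (φ : E3 → ℝ) (hφ : IsTest φ),
      q = (hφ.toL2, fun j => (hφ.pd j).toL2, fun j => ((hφ.pd j).pd j).toL2)} with hQ
  -- No spatial cutoff is needed: with every derivative on a kernel, `R n` is continuous on all of
  -- `L²` and maps test functions into `Q`, so plain `L²` density suffices. Two mollifications leave
  -- one kernel for each derivative.
  let R : ℕ → L2 → L2 × (Fin 3 → L2) × (Fin 3 → L2) := fun n h =>
    (smooth n (smooth n h), fun j => dsmooth n j (smooth n h), fun j => dsmooth n j (dsmooth n j h))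
  have hR : ∀ n, R n g ∈ closure Q := by
    intro n
    have hc : Continuous (R n) := by
      refine Continuous.prodMk (by fun_prop) (Continuous.prodMk ?_ ?_) <;>
      exact continuous_pi fun j => by fun_prop
    refine map_mem_closure hc (dense_testSet g) ?_
    rintro _ ⟨ψ, hψ, rfl⟩
    have hk := isTest_ker n
    refine ⟨_, hk.conv (hk.conv hψ), ?_⟩
    simp only [R, smooth, dsmooth, moll_toL2]
    refine Prod.ext rfl (Prod.ext (funext fun j => ?_) (funext fun j => ?_))
    · exact toL2_congr ((hk.pd j).conv (hk.conv hψ)) ((hk.conv (hk.conv hψ)).pd j)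
        (pd_conv_left hk (hk.conv hψ) j).symm
    · refine toL2_congr ((hk.pd j).conv ((hk.pd j).conv hψ)) (((hk.conv (hk.conv hψ)).pd j).pd j) ?_
      rw [pd_conv hk (hk.conv hψ), pd_conv_left hk ((hk.conv hψ).pd j), pd_conv_left hk hψ]
  refine isClosed_closure.mem_of_tendsto (b := atTop) ?_ (Eventually.of_forall hR)
  refine Tendsto.prodMk_nhds (tendsto_smooth_smooth g) (Tendsto.prodMk_nhds ?_ ?_)
  · refine tendsto_pi_nhds.2 fun j => ?_
    simp only [((hd j).smooth _).dsmooth_eq]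
    exact tendsto_smooth_smooth _
  · refine tendsto_pi_nhds.2 fun j => ?_
    simp only [(hd j).dsmooth_eq, ((he j).smooth _).dsmooth_eq]
    exact tendsto_smooth_smooth _

/-- Test functions are dense in `H¹`. -/
theorem mem_closure_test_sobolev_one {g : L2} {d : Fin 3 → L2}
    (hd : ∀ j, HasWeakPartial j g (d j)) :
    (g, d) ∈ closure {q : L2 × (Fin 3 → L2) | ∃ (φ : E3 → ℝ) (hφ : IsTest φ),
      q = (hφ.toL2, fun j => (hφ.pd j).toL2)} := by
  set Q := {q : L2 × (Fin 3 → L2) | ∃ (φ : E3 → ℝ) (hφ : IsTest φ),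
      q = (hφ.toL2, fun j => (hφ.pd j).toL2)} with hQ
  let R : ℕ → L2 → L2 × (Fin 3 → L2) := fun n h => (smooth n h, fun j => dsmooth n j h)
  have hR : ∀ n, R n g ∈ closure Q := by
    intro n
    have hc : Continuous (R n) :=
      Continuous.prodMk (by fun_prop) (continuous_pi fun j => by fun_prop)
    refine map_mem_closure hc (dense_testSet g) ?_
    rintro _ ⟨ψ, hψ, rfl⟩
    have hk := isTest_ker n
    refine ⟨_, hk.conv hψ, ?_⟩
    simp only [R, smooth, dsmooth, moll_toL2]
    exact Prod.ext rfl (funext fun j => toL2_congr ((hk.pd j).conv hψ) ((hk.conv hψ).pd j)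
      (pd_conv_left hk hψ j).symm)
  refine isClosed_closure.mem_of_tendsto (b := atTop) ?_ (Eventually.of_forall hR)
  refine Tendsto.prodMk_nhds (tendsto_smooth g) (tendsto_pi_nhds.2 fun j => ?_)
  simp only [(hd j).dsmooth_eq]
  exact tendsto_smooth _

/-- Integration by parts for two functions with one weak derivative. -/
theorem HasWeakPartial.inner_eq_neg {j : Fin 3} {g d h e : L2}
    (hg : HasWeakPartial j g d) (hh : HasWeakPartial j h e) :
    inner ℝ g e = -inner ℝ d h := by
  -- For fixed `n` both sides are continuous in `h ∈ L²`, so `h` may be a test function, and the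
  -- definition of the derivative of `g` applies. The derivative of `h` enters only in the limit.
  have key : ∀ n, inner ℝ g (dsmooth n j h) = -inner ℝ d (Bardina.smooth n h) := by
    intro n
    have hc : IsClosed {h : L2 | inner ℝ g (dsmooth n j h) = -inner ℝ d (Bardina.smooth n h)} :=
      isClosed_eq (by fun_prop) (by fun_prop)
    refine hc.closure_subset_iff.2 ?_ (dense_testSet h)
    rintro _ ⟨ψ, hψ, rfl⟩
    have hk := isTest_ker n
    simp only [mem_ofPred_eq, Bardina.smooth, dsmooth, moll_toL2]
    rw [← hasWeakPartial_iff.1 hg _ (hk.conv hψ)]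
    congr 1
    exact toL2_congr _ _ (pd_conv_left hk hψ j).symm
  have h1 : Tendsto (fun n => inner ℝ g (dsmooth n j h)) atTop (𝓝 (inner ℝ g e)) := by
    simp only [hh.dsmooth_eq]
    exact tendsto_const_nhds.inner (tendsto_smooth e)
  have h2 : Tendsto (fun n => -inner ℝ d (Bardina.smooth n h)) atTop (𝓝 (-inner ℝ d h)) :=
    (tendsto_const_nhds.inner (tendsto_smooth h)).neg
  simp only [key] at h1
  exact tendsto_nhds_unique h1 h2

/-! ### Sobolev inequality -/

theorem norm_fderiv_le_sum_pd (φ : E3 → ℝ) (x : E3) : ‖fderiv ℝ φ x‖ ≤ ∑ j, |pd j φ x| := by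
  refine ContinuousLinearMap.opNorm_le_bound _ (Finset.sum_nonneg fun _ _ => abs_nonneg _)
    fun v => ?_
  have hv : v = ∑ j, v j • EuclideanSpace.single j (1 : ℝ) := by
    ext i
    simp [Finset.sum_apply, Pi.single_apply]
  conv_lhs => rw [hv]
  rw [map_sum, Finset.sum_mul]
  refine (norm_sum_le _ _).trans (Finset.sum_le_sum fun j _ => ?_)
  rw [map_smul, norm_smul, mul_comm]
  exact mul_le_mul_of_nonneg_left (PiLp.norm_apply_le v j) (norm_nonneg _)

/-- Gagliardo–Nirenberg–Sobolev in dimension three: `1/6 = 1/2 - 1/3`. -/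
theorem exists_eLpNorm_six_test_le : ∃ C : NNReal, ∀ (φ : E3 → ℝ) (hφ : IsTest φ),
    eLpNorm φ 6 volume ≤ C * ∑ j, ‖(hφ.pd j).toL2‖ₑ := by
  refine ⟨eLpNormLESNormFDerivOfEqInnerConst (volume : Measure E3) ((2 : NNReal) : ℝ),
    fun φ hφ => ?_⟩
  have h := eLpNorm_le_eLpNorm_fderiv_of_eq_inner (volume : Measure E3) (u := φ)
    (hφ.1.of_le (by simp)) hφ.2 (p := 2) (p' := 6) (by norm_num) (by simp)
    (by simp; norm_num)
  have e6 : ((6 : NNReal) : ENNReal) = 6 := by norm_num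
  have e2 : ((2 : NNReal) : ENNReal) = 2 := by norm_num
  rw [e6, e2] at h
  refine h.trans ?_
  gcongr
  calc eLpNorm (fderiv ℝ φ) 2 volume
      ≤ eLpNorm (∑ j, fun x => |pd j φ x|) 2 volume := by
        refine eLpNorm_mono fun x => ?_
        rw [Finset.sum_apply, Real.norm_of_nonneg (Finset.sum_nonneg fun _ _ => abs_nonneg _)]
        exact norm_fderiv_le_sum_pd φ x
    _ ≤ ∑ j, eLpNorm (fun x => |pd j φ x|) 2 volume :=
        eLpNorm_sum_le (fun j _ => ((hφ.pd j).continuous.abs).aestronglyMeasurable) (by norm_num)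
    _ = ∑ j, ‖(hφ.pd j).toL2‖ₑ := by
        refine Finset.sum_congr rfl fun j _ => ?_
        rw [Lp.enorm_def, eLpNorm_congr_ae (hφ.pd j).coeFn_toL2]
        exact eLpNorm_norm (pd j φ)

/-- Approximate in `H¹` by test functions; along an almost everywhere convergent subsequence,
Fatou's lemma passes the `L⁶` bound to the limit. -/
theorem exists_eLpNorm_six_le : ∃ C : NNReal, ∀ (g : L2) (d : Fin 3 → L2),
    (∀ j, HasWeakPartial j g (d j)) → eLpNorm g 6 volume ≤ C * ∑ j, ‖d j‖ₑ := by
  obtain ⟨C, hC⟩ := exists_eLpNorm_six_test_le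
  refine ⟨C, fun g d hd => ?_⟩
  obtain ⟨q, hq, hlim⟩ := mem_closure_iff_seq_limit.1 (mem_closure_test_sobolev_one hd)
  choose φ hφ hqφ using hq
  have h1 : Tendsto (fun n => (hφ n).toL2) atTop (𝓝 g) := by
    have := (continuous_fst.tendsto _).comp hlim
    simpa [Function.comp_def, hqφ] using this
  have h2 : ∀ j, Tendsto (fun n => ((hφ n).pd j).toL2) atTop (𝓝 (d j)) := by
    intro j
    have := ((continuous_apply j).comp continuous_snd).tendsto _ |>.comp hlim
    simpa [Function.comp_def, hqφ] using this
  obtain ⟨ns, hns, hae⟩ := (tendstoInMeasure_of_tendsto_Lp h1).exists_seq_tendsto_ae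
  have h3 := Lp.eLpNorm_lim_le_liminf_eLpNorm (p := 6) (μ := (volume : Measure E3))
    (f := fun n => ((hφ (ns n)).toL2 : E3 → ℝ)) (fun n => Lp.aestronglyMeasurable _) g hae
  refine h3.trans ?_
  have h4 : Tendsto (fun n => (C : ENNReal) * ∑ j, ‖((hφ (ns n)).pd j).toL2‖ₑ) atTop
      (𝓝 (C * ∑ j, ‖d j‖ₑ)) := by
    refine ENNReal.Tendsto.const_mul ?_ (Or.inr ENNReal.coe_ne_top)
    exact tendsto_finsetSum _ fun j _ => ((h2 j).comp hns.tendsto_atTop).enorm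
  rw [← h4.liminf_eq]
  refine liminf_le_liminf (Eventually.of_forall fun n => ?_)
  rw [eLpNorm_congr_ae (hφ (ns n)).coeFn_toL2]
  exact hC _ (hφ (ns n))

/-- Cauchy–Schwarz for `|g|⁴ = |g|·|g|³`. -/
theorem eLpNorm_four_pow_le (g : L2) :
    eLpNorm g 4 volume ^ 4 ≤ eLpNorm g 2 volume * eLpNorm g 6 volume ^ 3 := by
  have hm : AEMeasurable (fun x => ‖g x‖ₑ) volume := (Lp.aestronglyMeasurable g).enorm
  have h := ENNReal.lintegral_mul_le_Lp_mul_Lq (volume : Measure E3)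
    (p := 2) (q := 2) ⟨by norm_num, by norm_num, by norm_num⟩ hm (hm.pow_const 3)
  have a4 := eLpNorm_nnreal_pow_eq_lintegral (f := g) (μ := (volume : Measure E3))
    (p := 4) (by norm_num)
  have a2 := eLpNorm_nnreal_pow_eq_lintegral (f := g) (μ := (volume : Measure E3))
    (p := 2) (by norm_num)
  have a6 := eLpNorm_nnreal_pow_eq_lintegral (f := g) (μ := (volume : Measure E3))
    (p := 6) (by norm_num)
  have e6 : ((6 : NNReal) : ENNReal) = 6 := by norm_num
  have e4 : ((4 : NNReal) : ENNReal) = 4 := by norm_num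
  have e2 : ((2 : NNReal) : ENNReal) = 2 := by norm_num
  have r6 : ((6 : NNReal) : ℝ) = 6 := by norm_num
  have r4 : ((4 : NNReal) : ℝ) = 4 := by norm_num
  have r2 : ((2 : NNReal) : ℝ) = 2 := by norm_num
  rw [e4, r4] at a4
  rw [e2, r2] at a2
  rw [e6, r6] at a6
  have l1 : ∫⁻ a, ((fun x => ‖g x‖ₑ) * fun x => ‖g x‖ₑ ^ 3) a = ∫⁻ x, ‖g x‖ₑ ^ (4 : ℝ) := by
    refine lintegral_congr fun x => ?_
    rw [Pi.mul_apply, ← pow_succ']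
    norm_cast
  have l2 : ∫⁻ a, (‖g a‖ₑ ^ 3) ^ (2 : ℝ) = ∫⁻ x, ‖g x‖ₑ ^ (6 : ℝ) := by
    refine lintegral_congr fun x => ?_
    rw [← ENNReal.rpow_natCast, ← ENNReal.rpow_mul]
    norm_num
  rw [l1, l2, ← a4, ← a2, ← a6, ← ENNReal.rpow_mul, ← ENNReal.rpow_mul] at h
  norm_num at h
  exact_mod_cast h

/-- The `H¹` size of a function with gradient `d`. -/
def sobSize (g : L2) (d : Fin 3 → L2) : ℝ := ‖g‖ + ∑ j, ‖d j‖

theorem sobSize_nonneg (g : L2) (d : Fin 3 → L2) : 0 ≤ sobSize g d := by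
  unfold sobSize; positivity

theorem exists_eLpNorm_four_le : ∃ C : NNReal, ∀ (g : L2) (d : Fin 3 → L2),
    (∀ j, HasWeakPartial j g (d j)) → eLpNorm g 4 volume ≤ ENNReal.ofReal (C * sobSize g d) := by
  obtain ⟨C, hC⟩ := exists_eLpNorm_six_le
  -- `C + 1` dominates both the constant `1` of the `L²` factor and the constant `C` of the `L⁶`
  -- factor.
  refine ⟨C + 1, fun g d hd => ?_⟩
  set X : ENNReal := ENNReal.ofReal (sobSize g d) with hX
  have hsum : ∑ j, ‖d j‖ₑ = ENNReal.ofReal (∑ j, ‖d j‖) := by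
    rw [ENNReal.ofReal_sum_of_nonneg fun _ _ => norm_nonneg _]
    simp only [ofReal_norm]
  have h6 : eLpNorm g 6 volume ≤ C * X := by
    refine (hC g d hd).trans ?_
    gcongr
    rw [hsum]
    exact ENNReal.ofReal_le_ofReal (le_add_of_nonneg_left (norm_nonneg _))
  have h2 : eLpNorm g 2 volume ≤ X := by
    rw [← Lp.enorm_def, ← ofReal_norm]
    exact ENNReal.ofReal_le_ofReal
      (le_add_of_nonneg_right (Finset.sum_nonneg fun _ _ => norm_nonneg _))
  have h4 : eLpNorm g 4 volume ^ 4 ≤ ((C + 1) * X) ^ 4 := by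
    refine (eLpNorm_four_pow_le g).trans ?_
    calc eLpNorm g 2 volume * eLpNorm g 6 volume ^ 3 ≤ ((C + 1) * X) * ((C + 1) * X) ^ 3 := by
          gcongr
          · refine h2.trans ?_
            conv_lhs => rw [← one_mul X]
            gcongr
            exact le_add_self
          · refine h6.trans ?_
            gcongr
            exact le_self_add
      _ = _ := by ring
  have h5 := (ENNReal.pow_le_pow_left_iff (by norm_num)).1 h4
  refine h5.trans (le_of_eq ?_)
  rw [ENNReal.ofReal_mul (by positivity)]
  simp [ENNReal.ofReal_add, hX]

/-- Hölder with `1/4 + 1/4 = 1/2` and the embedding of `H¹` in `L⁴`. This makes `u ⊗ u` square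
integrable. -/
theorem exists_norm_mul_le : ∃ C : ℝ, 0 ≤ C ∧ ∀ (g h : L2) (d e : Fin 3 → L2),
    (∀ j, HasWeakPartial j g (d j)) → (∀ j, HasWeakPartial j h (e j)) →
    ∃ q : L2, q =ᵐ[volume] (fun x => g x * h x) ∧ ‖q‖ ≤ C * (sobSize g d * sobSize h e) := by
  obtain ⟨C, hC⟩ := exists_eLpNorm_four_le
  refine ⟨C * C, by positivity, fun g h d e hd he => ?_⟩
  have : ENNReal.HolderTriple 4 4 2 := ⟨by
    rw [← two_mul, show (4 : ENNReal) = 2 * 2 by norm_num,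
      ENNReal.mul_inv (by norm_num) (by norm_num), ← mul_assoc,
      ENNReal.mul_inv_cancel (by norm_num) (by norm_num), one_mul]⟩
  have hle := eLpNorm_smul_le_mul_eLpNorm (p := 4) (q := 4) (r := 2)
    (Lp.aestronglyMeasurable h) (Lp.aestronglyMeasurable g)
  have hle2 : eLpNorm (fun x => g x * h x) 2 volume
      ≤ ENNReal.ofReal (C * C * (sobSize g d * sobSize h e)) := by
    refine hle.trans ((mul_le_mul' (hC g d hd) (hC h e he)).trans (le_of_eq ?_))
    rw [← ENNReal.ofReal_mul (mul_nonneg C.coe_nonneg (sobSize_nonneg g d))]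
    congr 1; ring
  have hmem : MemLp (fun x => g x * h x) 2 volume :=
    ⟨(Lp.aestronglyMeasurable g).mul (Lp.aestronglyMeasurable h),
      hle2.trans_lt ENNReal.ofReal_lt_top⟩
  refine ⟨hmem.toLp _, hmem.coeFn_toLp, ?_⟩
  rw [Lp.norm_toLp]
  exact ENNReal.toReal_le_of_le_ofReal
    (mul_nonneg (by positivity) (mul_nonneg (sobSize_nonneg _ _) (sobSize_nonneg _ _))) hle2

/-- Constant in the product estimate `‖g h‖_{L²} ≤ C ‖g‖_{H¹} ‖h‖_{H¹}`. -/
def mulConst : ℝ := exists_norm_mul_le.choose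

theorem mulConst_nonneg : 0 ≤ mulConst := exists_norm_mul_le.choose_spec.1

theorem norm_le_of_ae_eq_mul {g h q : L2} {d e : Fin 3 → L2}
    (hd : ∀ j, HasWeakPartial j g (d j)) (he : ∀ j, HasWeakPartial j h (e j))
    (hq : q =ᵐ[volume] fun x => g x * h x) :
    ‖q‖ ≤ mulConst * (sobSize g d * sobSize h e) := by
  obtain ⟨q', hq', hle⟩ := exists_norm_mul_le.choose_spec.2 g h d e hd he
  rwa [show q = q' from Lp.ext (hq.trans hq'.symm)]

theorem exists_ae_eq_mul {g h : L2} {d e : Fin 3 → L2}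
    (hd : ∀ j, HasWeakPartial j g (d j)) (he : ∀ j, HasWeakPartial j h (e j)) :
    ∃ q : L2, q =ᵐ[volume] fun x => g x * h x := by
  obtain ⟨q, hq, -⟩ := exists_norm_mul_le.choose_spec.2 g h d e hd he
  exact ⟨q, hq⟩

/-! ### Divergence-free fields -/

theorem isDivFree_iff {u : VL2} : IsDivFree u ↔ ∀ (φ : E3 → ℝ) (hφ : IsTest φ),
    ∑ i, inner ℝ (u i) (hφ.pd i).toL2 = 0 := by
  refine forall_congr' fun φ => forall_congr' fun hφ => ?_
  rw [integral_finsetSum _ fun i _ => integrable_mul_test (u i) (hφ.pd i)]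
  simp only [inner_toL2]

/-- Divergence-free fields are orthogonal to gradients. -/
theorem IsDivFree.sum_inner_eq_zero {u : VL2} (hu : IsDivFree u) {g : L2} {d : Fin 3 → L2}
    (hd : ∀ j, HasWeakPartial j g (d j)) : ∑ i, inner ℝ (u i) (d i) = 0 := by
  have hc : IsClosed {q : L2 × (Fin 3 → L2) | ∑ i, inner ℝ (u i) (q.2 i) = 0} :=
    isClosed_eq (by fun_prop) continuous_const
  refine hc.closure_subset_iff.2 ?_ (mem_closure_test_sobolev_one hd)
  rintro _ ⟨φ, hφ, rfl⟩
  exact isDivFree_iff.1 hu φ hφ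

/-- The trilinear cancellation `∫ (u · ∇ g) g = 0`. -/
theorem IsDivFree.sum_inner_mul_eq_zero {u : VL2} (hu : IsDivFree u) {e : Fin 3 → Fin 3 → L2}
    (he : ∀ i j, HasWeakPartial j (u i) (e i j)) {g : L2} {d : Fin 3 → L2}
    (hd : ∀ j, HasWeakPartial j g (d j)) {q : Fin 3 → L2}
    (hq : ∀ j, q j =ᵐ[volume] fun x => g x * u j x) : ∑ j, inner ℝ (q j) (d j) = 0 := by
  obtain ⟨r, hr, hlim⟩ := mem_closure_iff_seq_limit.1 (mem_closure_test_sobolev_one hd)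
  choose φ hφ hrφ using hr
  have h1 : Tendsto (fun n => (hφ n).toL2) atTop (𝓝 g) := by
    have := (continuous_fst.tendsto _).comp hlim
    simpa [Function.comp_def, hrφ] using this
  have h2 : ∀ j, Tendsto (fun n => ((hφ n).pd j).toL2) atTop (𝓝 (d j)) := by
    intro j
    have := ((continuous_apply j).comp continuous_snd).tendsto _ |>.comp hlim
    simpa [Function.comp_def, hrφ] using this
  have hex : ∀ n j, ∃ s : L2, s =ᵐ[volume] fun x => (hφ n).toL2 x * u j x := fun n j =>
    exists_ae_eq_mul (fun k => (hφ n).hasWeakPartial k) (he j)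
  choose s hs using hex
  -- The product estimate makes multiplication by `u j` continuous from `H¹` to `L²`.
  have hsq : ∀ j, Tendsto (fun n => s n j) atTop (𝓝 (q j)) := by
    intro j
    rw [tendsto_iff_norm_sub_tendsto_zero]
    have hb : ∀ n, ‖s n j - q j‖ ≤ mulConst *
        (sobSize ((hφ n).toL2 - g) (fun k => ((hφ n).pd k).toL2 - d k) * sobSize (u j) (e j)) := by
      intro n
      refine norm_le_of_ae_eq_mul (fun k => ((hφ n).hasWeakPartial k).sub (hd k)) (he j) ?_
      filter_upwards [Lp.coeFn_sub (s n j) (q j), Lp.coeFn_sub (hφ n).toL2 g, hs n j, hq j]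
        with x a b c f
      rw [a, b, Pi.sub_apply, Pi.sub_apply, c, f]; ring
    refine squeeze_zero (fun _ => norm_nonneg _) hb ?_
    have h0 : Tendsto (fun n => sobSize ((hφ n).toL2 - g) (fun k => ((hφ n).pd k).toL2 - d k))
        atTop (𝓝 0) := by
      unfold sobSize
      have a := (h1.sub_const g).norm
      have b := tendsto_finsetSum Finset.univ fun j _ => ((h2 j).sub_const (d j)).norm
      simpa using a.add b
    simpa using (h0.mul_const (sobSize (u j) (e j))).const_mul mulConst
  have hzero : ∀ n, ∑ j, inner ℝ (s n j) ((hφ n).pd j).toL2 = 0 := by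
    intro n
    -- The square of a test function is a test function with gradient `2φ∇φ`, so the cancellation is
    -- the divergence condition tested with `φ²`.
    have h := isDivFree_iff.1 hu _ ((hφ n).mul (hφ n))
    have hterm : ∀ j, inner ℝ (u j) (((hφ n).mul (hφ n)).pd j).toL2
        = 2 * inner ℝ (s n j) ((hφ n).pd j).toL2 := by
      intro j
      rw [inner_toL2, inner_toL2, ← integral_const_mul, pd_mul (hφ n) (hφ n)]
      refine integral_congr_ae ?_
      filter_upwards [hs n j, (hφ n).coeFn_toL2] with x a b
      rw [a, b]; ring
    simp only [hterm, ← Finset.mul_sum] at h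
    linarith
  have hl : Tendsto (fun n => ∑ j, inner ℝ (s n j) ((hφ n).pd j).toL2) atTop
      (𝓝 (∑ j, inner ℝ (q j) (d j))) :=
    tendsto_finsetSum _ fun j _ => (hsq j).inner (h2 j)
  simp only [hzero] at hl
  exact (tendsto_nhds_unique tendsto_const_nhds hl).symm

/-! ### Hilbert space tools -/

section Hilbert

variable {H : Type*} [NormedAddCommGroup H] [InnerProductSpace ℝ H]

/-- A linear functional controlled by `‖M v‖` is represented by pairing `M v` with a vector. -/
theorem exists_inner_eq_of_abs_le [CompleteSpace H] {V : Type*} [AddCommGroup V] [Module ℝ V]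
    (M : V →ₗ[ℝ] H) (l : V →ₗ[ℝ] ℝ) {C : ℝ} (hC : 0 ≤ C) (h : ∀ v, |l v| ≤ C * ‖M v‖) :
    ∃ F : H, ‖F‖ ≤ C ∧ ∀ v, inner ℝ F (M v) = l v := by
  -- The bound makes `l` factor through the range of `M`, where it is continuous; Hahn–Banach
  -- extends it to `H` and the Riesz theorem represents it.
  have hker : LinearMap.ker M ≤ LinearMap.ker l := by
    intro v hv
    rw [LinearMap.mem_ker] at hv ⊢
    have := h v
    rw [hv, norm_zero, mul_zero] at this
    exact abs_nonpos_iff.1 this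
  let f₀ : LinearMap.range M →ₗ[ℝ] ℝ :=
    ((LinearMap.ker M).liftQ l hker) ∘ₗ M.quotKerEquivRange.symm.toLinearMap
  have hf₀ : ∀ v, f₀ ⟨M v, v, rfl⟩ = l v := by
    intro v
    have e : M.quotKerEquivRange.symm ⟨M v, v, rfl⟩ = (LinearMap.ker M).mkQ v := by
      rw [LinearEquiv.symm_apply_eq]
      rfl
    simp only [f₀, LinearMap.comp_apply, LinearEquiv.coe_coe, e]
    rfl
  have hb : ∀ y, ‖f₀ y‖ ≤ C * ‖y‖ := by
    rintro ⟨_, v, rfl⟩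
    rw [hf₀, Real.norm_eq_abs]
    exact h v
  obtain ⟨g, hg, hgn⟩ := exists_extension_norm_eq (LinearMap.range M) (f₀.mkContinuous C hb)
  refine ⟨(InnerProductSpace.toDual ℝ H).symm g, ?_, fun v => ?_⟩
  · rw [LinearIsometryEquiv.norm_map, hgn]
    exact LinearMap.mkContinuous_norm_le _ hC _
  · rw [InnerProductSpace.toDual_symm_apply]
    exact (hg ⟨M v, v, rfl⟩).trans (hf₀ v)

/-- Orthonormal vectors are `√2` apart, so balls of radius `1/2` around them are disjoint open sets
in a second countable space. -/
theorem countable_of_orthonormal [SecondCountableTopology H] {ι : Type*} {b : ι → H}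
    (hb : Orthonormal ℝ b) : Countable ι := by
  refine Pairwise.countable_of_isOpen_disjoint (s := fun i => Metric.ball (b i) (1 / 2))
    (fun i j hij => ?_) (fun i => Metric.isOpen_ball) fun i => ⟨b i, by simp⟩
  refine Metric.ball_disjoint_ball ?_
  rw [dist_eq_norm]
  have h2 : ‖b i - b j‖ ^ 2 = 2 := by
    rw [@norm_sub_sq ℝ, hb.1 i, hb.1 j, hb.2 hij]; norm_num
  nlinarith [norm_nonneg (b i - b j)]

/-- In a separable Hilbert space, weak measurability on a dense set implies strong
measurability. -/
theorem aestronglyMeasurable_of_inner [CompleteSpace H] [SecondCountableTopology H]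
    {Ω : Type*} [MeasurableSpace Ω] {μ : Measure Ω} {f : Ω → H} {D : Set H} (hD : Dense D)
    (h : ∀ d ∈ D, AEStronglyMeasurable (fun t => inner ℝ (f t) d) μ) :
    AEStronglyMeasurable f μ := by
  have hall : ∀ k : H, AEStronglyMeasurable (fun t => inner ℝ (f t) k) μ := by
    intro k
    obtain ⟨d, hd, hlim⟩ := mem_closure_iff_seq_limit.1 (hD k)
    exact aestronglyMeasurable_of_tendsto_ae atTop (fun n => h (d n) (hd n))
      (Eventually.of_forall fun t => tendsto_const_nhds.inner hlim)
  obtain ⟨w, b, -⟩ := exists_hilbertBasis ℝ H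
  -- Countability of the basis makes `atTop` on its finite subsets countably generated, as a
  -- measurable limit requires.
  have : Countable w := countable_of_orthonormal b.orthonormal
  refine aestronglyMeasurable_of_tendsto_ae (u := (atTop : Filter (Finset w)))
    (f := fun s t => ∑ i ∈ s, b.repr (f t) i • b i) (fun s => ?_)
    (Eventually.of_forall fun t => b.hasSum_repr (f t))
  refine Finset.aestronglyMeasurable_fun_sum _ fun i _ => ?_
  refine AEStronglyMeasurable.smul_const ?_ _
  refine (hall (b i)).congr (Eventually.of_forall fun t => ?_)
  simp only []
  rw [b.repr_apply_apply, real_inner_comm]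

end Hilbert

/-! ### The Helmholtz operator -/

/-- `φ - α² Δ φ` for a smooth function `φ`. -/
def helm (α : ℝ) (φ : E3 → ℝ) : E3 → ℝ := fun x => φ x - α ^ 2 * lap φ x

theorem IsTest.helm {φ : E3 → ℝ} (hφ : IsTest φ) (α : ℝ) : IsTest (helm α φ) :=
  hφ.sub (hφ.lap.const_mul _)

theorem toL2_lap {φ : E3 → ℝ} (hφ : IsTest φ) :
    hφ.lap.toL2 = ∑ j, ((hφ.pd j).pd j).toL2 := by
  have h : lap φ = fun x => pd 0 (pd 0 φ) x + pd 1 (pd 1 φ) x + pd 2 (pd 2 φ) x := by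
    funext x; simp [lap, Fin.sum_univ_three]
  rw [Fin.sum_univ_three, ← toL2_add, ← toL2_add]
  exact toL2_congr _ _ h

theorem toL2_helm {φ : E3 → ℝ} (hφ : IsTest φ) (α : ℝ) :
    (hφ.helm α).toL2 = hφ.toL2 - α ^ 2 • ∑ j, ((hφ.pd j).pd j).toL2 := by
  rw [← toL2_lap hφ, ← toL2_const_mul hφ.lap, ← toL2_sub hφ]
  rfl

/-- Integration by parts turns the Helmholtz operator into the `𝓗¹_α` form. -/
theorem inner_sub_laplacian {g h : L2} {d d' e : Fin 3 → L2} (α : ℝ)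
    (hg : ∀ j, HasWeakPartial j g (d' j))
    (he : ∀ j, HasWeakPartial j (d j) (e j)) :
    inner ℝ g (h - α ^ 2 • ∑ j, e j) = inner ℝ g h + α ^ 2 * ∑ j, inner ℝ (d' j) (d j) := by
  have hj : ∀ j, inner ℝ g (e j) = -inner ℝ (d' j) (d j) := fun j => (hg j).inner_eq_neg (he j)
  rw [inner_sub_right, real_inner_smul_right, inner_sum]
  simp only [hj, Finset.sum_neg_distrib]
  ring

/-- With `a = ‖φ‖` and `b = ‖φ - α²Δφ‖`, pairing the Helmholtz operator with `φ` gives `a² + α²‖∇φ‖²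
≤ ab`, and `ab - a² ≤ b²/4`. -/
theorem norm_pd_le_helm {α : ℝ} (hα : 0 < α) {φ : E3 → ℝ} (hφ : IsTest φ) (j : Fin 3) :
    ‖(hφ.pd j).toL2‖ ≤ α⁻¹ * ‖(hφ.helm α).toL2‖ := by
  have h := inner_sub_laplacian (h := hφ.toL2) α (fun k => hφ.hasWeakPartial k)
    (fun k => (hφ.pd k).hasWeakPartial k)
  rw [← toL2_helm hφ α] at h
  simp only [real_inner_self_eq_norm_sq] at h
  have hcs := real_inner_le_norm hφ.toL2 (hφ.helm α).toL2
  rw [h] at hcs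
  set a := ‖hφ.toL2‖
  set b := ‖(hφ.helm α).toL2‖
  have hj : ‖(hφ.pd j).toL2‖ ^ 2 ≤ ∑ k, ‖(hφ.pd k).toL2‖ ^ 2 :=
    Finset.single_le_sum (f := fun k => ‖(hφ.pd k).toL2‖ ^ 2) (fun _ _ => sq_nonneg _)
      (Finset.mem_univ j)
  have h3 : (α * ‖(hφ.pd j).toL2‖) ^ 2 ≤ b ^ 2 := by
    have : α ^ 2 * ‖(hφ.pd j).toL2‖ ^ 2 ≤ α ^ 2 * ∑ k, ‖(hφ.pd k).toL2‖ ^ 2 := by gcongr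
    nlinarith [sq_nonneg (a - b / 2), sq_nonneg b]
  have h4 := abs_le_of_sq_le_sq h3 (norm_nonneg _)
  rw [inv_mul_eq_div, le_div_iff₀ hα, mul_comm]
  exact (le_abs_self _).trans h4

/-- Test functions as a vector space. -/
def testSpace : Submodule ℝ (E3 → ℝ) where
  carrier := {φ | IsTest φ}
  add_mem' ha hb := IsTest.add ha hb
  zero_mem' := ⟨contDiff_const, HasCompactSupport.zero⟩
  smul_mem' c _ h := IsTest.const_mul h c

/-- The inclusion of test functions into `L²`. -/
def testToL2 : testSpace →ₗ[ℝ] L2 where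
  toFun φ := IsTest.toL2 φ.2
  map_add' φ ψ := toL2_add φ.2 ψ.2
  map_smul' c φ := toL2_const_mul φ.2 c

/-- Partial derivatives on test functions. -/
def testPd (j : Fin 3) : testSpace →ₗ[ℝ] testSpace where
  toFun φ := ⟨pd j φ.1, IsTest.pd φ.2 j⟩
  map_add' φ ψ := Subtype.ext (pd_add φ.2 ψ.2 j)
  map_smul' c φ := Subtype.ext (pd_const_mul φ.2 c j)

/-- The Helmholtz operator on test functions, with values in `L²`. -/
def testHelm (α : ℝ) : testSpace →ₗ[ℝ] L2 :=
  testToL2 - α ^ 2 • ∑ j, testToL2 ∘ₗ testPd j ∘ₗ testPd j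

theorem testHelm_apply (α : ℝ) {φ : E3 → ℝ} (hφ : IsTest φ) :
    testHelm α ⟨φ, hφ⟩ = (hφ.helm α).toL2 := by
  rw [toL2_helm hφ]
  simp only [testHelm, LinearMap.sub_apply, LinearMap.smul_apply, LinearMap.sum_apply]
  rfl

theorem inner_trans_eq (z : E3) (a : L2) {φ : E3 → ℝ} (hφ : IsTest φ) :
    inner ℝ (trans z a) hφ.toL2 = inner ℝ a (hφ.comp_sub (-z)).toL2 := by
  rw [inner_toL2, inner_toL2, ← integral_sub_right_eq_self (fun x => a x * φ (x - -z)) z]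
  refine integral_congr_ae ?_
  filter_upwards [coeFn_trans z a] with x hx
  rw [hx]; simp

theorem helm_comp_sub (α : ℝ) (φ : E3 → ℝ) (z : E3) :
    helm α (fun x => φ (x - z)) = fun x => helm α φ (x - z) := by
  funext x
  simp only [helm, lap, pd_comp_sub]

/-- There is no nonzero `L²` solution of the homogeneous Helmholtz equation. -/
theorem eq_zero_of_inner_helm {α : ℝ} {g : L2}
    (h : ∀ (φ : E3 → ℝ) (hφ : IsTest φ), inner ℝ g (hφ.helm α).toL2 = 0) : g = 0 := by
  -- The homogeneous equation is translation invariant, so mollification preserves it.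
  have hm : ∀ {k : E3 → ℝ} (hk : IsTest k) (a : L2),
      (∀ (φ : E3 → ℝ) (hφ : IsTest φ), inner ℝ a (hφ.helm α).toL2 = 0) →
      ∀ (φ : E3 → ℝ) (hφ : IsTest φ), inner ℝ (moll hk a) (hφ.helm α).toL2 = 0 := by
    intro k hk a ha φ hφ
    rw [inner_moll]
    refine integral_eq_zero_of_ae (Eventually.of_forall fun z => ?_)
    simp only [Pi.zero_apply]
    rw [inner_trans_eq, toL2_congr ((hφ.helm α).comp_sub (-z)) ((hφ.comp_sub (-z)).helm α)
      (helm_comp_sub α φ (-z)).symm, ha _ (hφ.comp_sub (-z)), mul_zero]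
  -- Mollified twice, the solution has the two derivatives needed for the equation to hold in `L²`;
  -- pairing it with the solution itself gives `‖k‖² + α²‖∇k‖² = 0`.
  have key : ∀ n, smooth n (smooth n g) = 0 := by
    intro n
    set k := smooth n (smooth n g) with hkdef
    have hk := hm (isTest_ker n) _ (hm (isTest_ker n) g h)
    have hd : ∀ j, HasWeakPartial j k (dsmooth n j (smooth n g)) :=
      fun j => hasWeakPartial_smooth n j _
    have hd' : ∀ j, dsmooth n j (smooth n g) = smooth n (dsmooth n j g) := fun j =>
      (hasWeakPartial_smooth n j g).dsmooth_eq n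
    have he : ∀ j, HasWeakPartial j (dsmooth n j (smooth n g)) (dsmooth n j (dsmooth n j g)) := by
      intro j
      rw [hd']
      exact hasWeakPartial_smooth n j _
    have hz : k - α ^ 2 • ∑ j, dsmooth n j (dsmooth n j g) = 0 := by
      refine eq_of_inner_test fun φ hφ => ?_
      rw [inner_zero_left, inner_sub_left, real_inner_smul_left, sum_inner]
      have h1 : ∀ j, inner ℝ (dsmooth n j (dsmooth n j g)) hφ.toL2
          = inner ℝ k ((hφ.pd j).pd j).toL2 := by
        intro j
        rw [hasWeakPartial_iff.1 (hd j) _ (hφ.pd j), hasWeakPartial_iff.1 (he j) _ hφ, neg_neg]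
      have h2 := hk φ hφ
      rw [toL2_helm hφ, inner_sub_right, real_inner_smul_right, inner_sum] at h2
      simp only [h1]
      exact h2
    have h3 := inner_sub_laplacian (h := k) α hd he
    rw [hz, inner_zero_right] at h3
    simp only [real_inner_self_eq_norm_sq] at h3
    have h4 : 0 ≤ α ^ 2 * ∑ j, ‖dsmooth n j (smooth n g)‖ ^ 2 := by positivity
    have h5 : ‖k‖ ^ 2 = 0 := by nlinarith [sq_nonneg ‖k‖]
    exact norm_eq_zero.1 (pow_eq_zero_iff (two_ne_zero) |>.1 h5)
  have hlim := tendsto_smooth_smooth g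
  simp only [key] at hlim
  exact (tendsto_nhds_unique tendsto_const_nhds hlim).symm

/-- A vector orthogonal to the range solves the homogeneous Helmholtz equation, hence is zero. Test
functions of the form `φ - α²Δφ` therefore suffice to identify `L²` functions. -/
theorem dense_range_testHelm (α : ℝ) : Dense (LinearMap.range (testHelm α) : Set L2) := by
  rw [Submodule.dense_iff_topologicalClosure_eq_top, Submodule.topologicalClosure_eq_top_iff,
    Submodule.eq_bot_iff]
  intro g hg
  refine eq_zero_of_inner_helm (α := α) fun φ hφ => ?_
  rw [← testHelm_apply α hφ]
  exact (Submodule.mem_orthogonal' _ _).1 hg _ ⟨_, rfl⟩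

/-- The filtered divergence: for `q ∈ L²` there is `N ∈ L²` with
`⟪N, φ - α² Δ φ⟫ = ∑ⱼ ⟪qⱼ, ∂ⱼ φ⟫`. -/
theorem exists_filtered_div {α : ℝ} (hα : 0 < α) (q : Fin 3 → L2) :
    ∃ N : L2, ‖N‖ ≤ α⁻¹ * ∑ j, ‖q j‖ ∧ ∀ (φ : E3 → ℝ) (hφ : IsTest φ),
      inner ℝ N (hφ.helm α).toL2 = ∑ j, inner ℝ (q j) (hφ.pd j).toL2 := by
  let l : testSpace →ₗ[ℝ] ℝ :=
    ∑ j, (innerSL ℝ (q j)).toLinearMap ∘ₗ testToL2 ∘ₗ testPd j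
  have hl : ∀ {φ : E3 → ℝ} (hφ : IsTest φ),
      l ⟨φ, hφ⟩ = ∑ j, inner ℝ (q j) (hφ.pd j).toL2 := by
    intro φ hφ
    simp only [l, LinearMap.sum_apply]
    rfl
  obtain ⟨N, hN, hN'⟩ := exists_inner_eq_of_abs_le (testHelm α) l
    (C := α⁻¹ * ∑ j, ‖q j‖) (by positivity) (by
      rintro ⟨φ, hφ⟩
      have hφ' : IsTest φ := hφ
      rw [hl hφ', testHelm_apply α hφ']
      refine (Finset.abs_sum_le_sum_abs _ _).trans ?_
      rw [Finset.mul_sum, Finset.sum_mul]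
      refine Finset.sum_le_sum fun j _ => ?_
      calc |inner ℝ (q j) (hφ'.pd j).toL2| ≤ ‖q j‖ * ‖(hφ'.pd j).toL2‖ :=
            abs_real_inner_le_norm _ _
        _ ≤ ‖q j‖ * (α⁻¹ * ‖(hφ'.helm α).toL2‖) := by gcongr; exact norm_pd_le_helm hα hφ' j
        _ = _ := by ring)
  refine ⟨N, hN, fun φ hφ => ?_⟩
  rw [← testHelm_apply α hφ, hN' ⟨φ, hφ⟩, hl hφ]

/-- Both sides are continuous in the function, its gradient and its pure second derivatives, so
density of test functions in `H²` allows `u` itself as a test function. -/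
theorem inner_filtered_div {α : ℝ} {q : Fin 3 → L2} {N : L2}
    (hN : ∀ (φ : E3 → ℝ) (hφ : IsTest φ),
      inner ℝ N (hφ.helm α).toL2 = ∑ j, inner ℝ (q j) (hφ.pd j).toL2)
    {g : L2} {d e : Fin 3 → L2}
    (hd : ∀ j, HasWeakPartial j g (d j)) (he : ∀ j, HasWeakPartial j (d j) (e j)) :
    inner ℝ N (g - α ^ 2 • ∑ j, e j) = ∑ j, inner ℝ (q j) (d j) := by
  let S : Set (L2 × (Fin 3 → L2) × (Fin 3 → L2)) :=
    {r | inner ℝ N (r.1 - α ^ 2 • ∑ j, r.2.2 j) = ∑ j, inner ℝ (q j) (r.2.1 j)}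
  have hc : IsClosed S := isClosed_eq (by fun_prop) (by fun_prop)
  have hmem : (g, d, e) ∈ S := by
    refine closure_minimal ?_ hc (mem_closure_test_sobolev_two hd he)
    rintro _ ⟨φ, hφ, rfl⟩
    change inner ℝ N (hφ.toL2 - α ^ 2 • ∑ j, ((hφ.pd j).pd j).toL2) = _
    rw [← toL2_helm hφ α]
    exact hN φ hφ
  exact hmem

instance isLocallyFiniteMeasure_timeMeasure : IsLocallyFiniteMeasure timeMeasure := by
  unfold timeMeasure; infer_instance

/-! ### Primitives of locally integrable Hilbert-valued functions -/

section Primitive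

variable {H : Type*} [NormedAddCommGroup H] [InnerProductSpace ℝ H]

theorem intervalIntegrable_of_locallyIntegrable {E : Type*} [NormedAddCommGroup E]
    {G : ℝ → E} (hG : LocallyIntegrable G volume) (s t : ℝ) : IntervalIntegrable G volume s t :=
  intervalIntegrable_iff.mpr
    ((hG.integrableOn_isCompact isCompact_uIcc).mono_set uIoc_subset_uIcc)

/-- The primitive `a + ∫₀ᵗ G`. -/
def prim (a : H) (G : ℝ → H) (t : ℝ) : H := a + ∫ s in (0 : ℝ)..t, G s

theorem prim_zero (a : H) (G : ℝ → H) : prim a G 0 = a := by simp [prim]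

theorem continuous_prim {G : ℝ → H} (hG : LocallyIntegrable G volume) (a : H) :
    Continuous (prim a G) :=
  continuous_const.add
    (intervalIntegral.continuous_primitive (intervalIntegrable_of_locallyIntegrable hG) 0)

theorem prim_sub {G : ℝ → H} (hG : LocallyIntegrable G volume) (a : H) (s t : ℝ) :
    prim a G t - prim a G s = ∫ r in s..t, G r := by
  have := intervalIntegral.integral_interval_sub_left
    (intervalIntegrable_of_locallyIntegrable hG 0 t) (intervalIntegrable_of_locallyIntegrable hG 0 s)
  rw [prim, prim, ← this]; abel

theorem ae_hasDerivAt_prim [CompleteSpace H] {G : ℝ → H} (hG : LocallyIntegrable G volume)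
    (a : H) : ∀ᵐ t, HasDerivAt (prim a G) (G t) t := by
  filter_upwards [_root_.LocallyIntegrable.ae_hasDerivAt_integral hG] with t ht
  exact (ht 0).const_add a

/-- Fundamental theorem of calculus for a function whose increments are controlled by the
integral of an integrable function. -/
theorem integral_eq_sub_of_abs_sub_le {Y Y' κ : ℝ → ℝ} {s t : ℝ}
    (hκ : IntervalIntegrable κ volume s t)
    (hY : ∀ x ∈ uIcc s t, ∀ y ∈ uIcc s t, |Y x - Y y| ≤ |∫ r in y..x, κ r|)
    (hd : ∀ᵐ r, HasDerivAt Y (Y' r) r) : ∫ r in s..t, Y' r = Y t - Y s := by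
  have hΦ := hκ.absolutelyContinuousOnInterval_intervalIntegral (c := s) left_mem_uIcc
  have hac : AbsolutelyContinuousOnInterval Y s t := by
    unfold AbsolutelyContinuousOnInterval at hΦ ⊢
    refine squeeze_zero' (Eventually.of_forall fun E => Finset.sum_nonneg fun _ _ => dist_nonneg)
      ?_ hΦ
    filter_upwards [mem_inf_of_right (mem_principal_self _)] with E hE
    refine Finset.sum_le_sum fun i hi => ?_
    obtain ⟨h1, h2⟩ := hE.1 i hi
    rw [Real.dist_eq, Real.dist_eq, intervalIntegral.integral_interval_sub_left]
    · exact hY _ h1 _ h2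
    · exact hκ.mono_set (uIcc_subset_uIcc left_mem_uIcc h1)
    · exact hκ.mono_set (uIcc_subset_uIcc left_mem_uIcc h2)
  rw [← hac.integral_deriv_eq_sub]
  refine intervalIntegral.integral_congr_ae ?_
  filter_upwards [hd] with r hr _
  exact hr.deriv.symm

/-- The curve is bounded by some `K` on the interval, so increments of its squared norm are at most
`2K` times the integral of `‖G‖`. This gives absolute continuity, and the pointwise chain rule holds
almost everywhere. -/
theorem norm_sq_prim_sub [CompleteSpace H] {G : ℝ → H} (hG : LocallyIntegrable G volume)
    (a : H) (s t : ℝ) :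
    ‖prim a G t‖ ^ 2 - ‖prim a G s‖ ^ 2 = 2 * ∫ r in s..t, inner ℝ (G r) (prim a G r) := by
  obtain ⟨K, hK⟩ := isCompact_uIcc.exists_bound_of_continuousOn
    (continuous_prim hG a).continuousOn (s := uIcc s t)
  have h := integral_eq_sub_of_abs_sub_le (s := s) (t := t)
    (Y := fun r => ‖prim a G r‖ ^ 2) (Y' := fun r => 2 * inner ℝ (prim a G r) (G r))
    (κ := fun r => 2 * K * ‖G r‖)
    ((intervalIntegrable_of_locallyIntegrable hG s t).norm.const_mul _) ?_ ?_
  · rw [← h, intervalIntegral.integral_const_mul]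
    simp only [real_inner_comm]
  · intro x hx y hy
    rw [intervalIntegral.integral_const_mul]
    have hKx := hK x hx
    have hKy := hK y hy
    have h1 : ‖prim a G x - prim a G y‖ ≤ |∫ r in y..x, ‖G r‖| := by
      rw [prim_sub hG]
      exact intervalIntegral.norm_integral_le_abs_integral_norm
    have h2 := abs_norm_sub_norm_le (prim a G x) (prim a G y)
    have h0 : 0 ≤ K := (norm_nonneg _).trans hKx
    rw [sq_sub_sq, abs_mul, abs_mul, abs_of_nonneg (by positivity : (0 : ℝ) ≤ 2 * K),
      abs_of_nonneg (by positivity : 0 ≤ ‖prim a G x‖ + ‖prim a G y‖)]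
    exact mul_le_mul (by linarith) (h2.trans h1) (abs_nonneg _) (by positivity)
  · filter_upwards [ae_hasDerivAt_prim hG a] with r hr
    exact hr.norm_sq

theorem clm_prim {K : Type*} [NormedAddCommGroup K] [InnerProductSpace ℝ K] [CompleteSpace K]
    [CompleteSpace H] {G : ℝ → H} (hG : LocallyIntegrable G volume) (B : H →L[ℝ] K) (a : H)
    (t : ℝ) : B (prim a G t) = prim (B a) (fun r => B (G r)) t := by
  rw [prim, prim, map_add,
    ContinuousLinearMap.intervalIntegral_comp_comm _ (intervalIntegrable_of_locallyIntegrable hG 0 t)]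

theorem locallyIntegrable_clm {K : Type*} [NormedAddCommGroup K] [NormedSpace ℝ K]
    {G : ℝ → H} (hG : LocallyIntegrable G volume) (B : H →L[ℝ] K) :
    LocallyIntegrable (fun r => B (G r)) volume := fun x => by
  obtain ⟨U, hU, hi⟩ := hG x
  exact ⟨U, hU, B.integrable_comp hi⟩

/-- Integration by parts of a primitive against a smooth function. -/
theorem integral_deriv_mul_prim [CompleteSpace H] {G : ℝ → H} (hG : LocallyIntegrable G volume)
    (a x : H) {θ : ℝ → ℝ} (hθ : ContDiff ℝ ∞ θ) (hc : HasCompactSupport θ) :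
    ∫ t, (deriv θ t * inner ℝ (prim a G t) x + θ t * inner ℝ (G t) x) ∂timeMeasure
      = -(θ 0 * inner ℝ a x) := by
  obtain ⟨R, hR0, hR⟩ : ∃ R : ℝ, 0 ≤ R ∧ ∀ t, R ≤ t → t ∉ tsupport θ := by
    obtain ⟨R, hR⟩ := hc.isCompact.isBounded.subset_closedBall 0
    refine ⟨|R| + 1, by positivity, fun t ht hts => ?_⟩
    have := hR hts
    rw [Metric.mem_closedBall, dist_zero_right, Real.norm_eq_abs] at this
    linarith [le_abs_self t, le_abs_self R]
  have hθ0 : ∀ t, R ≤ t → θ t = 0 := fun t ht => image_eq_zero_of_notMem_tsupport (hR t ht)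
  have hθ1 : ∀ t, R ≤ t → deriv θ t = 0 := fun t ht => by
    have : t ∉ tsupport (deriv θ) := fun h => hR t ht (closure_minimal
      (support_deriv_subset) (isClosed_tsupport _) h)
    exact image_eq_zero_of_notMem_tsupport this
  have hset : ∫ t, (deriv θ t * inner ℝ (prim a G t) x + θ t * inner ℝ (G t) x) ∂timeMeasure
      = ∫ t in (0 : ℝ)..R, (deriv θ t * inner ℝ (prim a G t) x + θ t * inner ℝ (G t) x) := by
    rw [intervalIntegral.integral_of_le hR0, timeMeasure, integral_Ici_eq_integral_Ioi]
    refine setIntegral_eq_of_subset_of_forall_sdiff_eq_zero measurableSet_Ioi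
      Ioc_subset_Ioi_self fun t ht => ?_
    have : R ≤ t := by
      by_contra h
      exact ht.2 ⟨ht.1, (not_le.1 h).le⟩
    rw [hθ0 t this, hθ1 t this]; ring
  have hin := locallyIntegrable_clm hG (innerSL ℝ x)
  have hp : ∀ t, inner ℝ (prim a G t) x
      = inner ℝ a x + ∫ r in (0 : ℝ)..t, inner ℝ (G r) x := by
    intro t
    have := clm_prim hG (innerSL ℝ x) a t
    simp only [innerSL_apply_apply, prim] at this
    rw [real_inner_comm, prim, this, real_inner_comm]
    simp only [real_inner_comm]
  have hac : AbsolutelyContinuousOnInterval (fun t => inner ℝ (prim a G t) x) 0 R := by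
    simp only [hp]
    have h1 : AbsolutelyContinuousOnInterval (fun _ : ℝ => inner ℝ a x) 0 R :=
      (contDiff_const.contDiffOn (n := 1)).absolutelyContinuousOnInterval
    refine h1.add (IntervalIntegrable.absolutelyContinuousOnInterval_intervalIntegral ?_
      left_mem_uIcc)
    have := intervalIntegrable_of_locallyIntegrable hin 0 R
    simpa [real_inner_comm] using this
  have hθac : AbsolutelyContinuousOnInterval θ 0 R :=
    ((hθ.of_le (by simp)).contDiffOn (n := 1)).absolutelyContinuousOnInterval
  have hibp := AbsolutelyContinuousOnInterval.integral_deriv_mul_eq_sub hθac hac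
  rw [hset]
  have hcongr : ∫ t in (0 : ℝ)..R, (deriv θ t * inner ℝ (prim a G t) x + θ t * inner ℝ (G t) x)
      = ∫ t in (0 : ℝ)..R, (deriv θ t * inner ℝ (prim a G t) x
        + θ t * deriv (fun t => inner ℝ (prim a G t) x) t) := by
    refine intervalIntegral.integral_congr_ae ?_
    filter_upwards [ae_hasDerivAt_prim hG a] with t ht _
    have := (ht.inner ℝ (hasDerivAt_const t x)).deriv
    simp only [inner_zero_right, zero_add] at this
    rw [this]
  rw [hcongr, hibp, hθ0 R le_rfl, prim_zero]
  ring

/-- A smooth compactly supported function on `(0, ∞)` is the derivative, on `[0, ∞)`, of a smooth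
compactly supported function on `ℝ`. -/
theorem exists_antideriv_test {g : ℝ → ℝ} (hg : ContDiff ℝ ∞ g) (hc : HasCompactSupport g) :
    ∃ θ : ℝ → ℝ, ContDiff ℝ ∞ θ ∧ HasCompactSupport θ ∧ ∀ t, 0 ≤ t → deriv θ t = g t := by
  obtain ⟨R, hR0, hR⟩ : ∃ R : ℝ, 0 ≤ R ∧ ∀ t, R ≤ t → g t = 0 := by
    obtain ⟨R, hR⟩ := hc.isCompact.isBounded.subset_closedBall 0
    refine ⟨|R| + 1, by positivity, fun t ht => image_eq_zero_of_notMem_tsupport fun hts => ?_⟩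
    have := hR hts
    rw [Metric.mem_closedBall, dist_zero_right, Real.norm_eq_abs] at this
    linarith [le_abs_self t, le_abs_self R]
  -- Integrating from `R` makes the primitive vanish beyond `R`. The cutoff `χ` below is `1` on
  -- `[-1, ∞)` and `0` on `(-∞, -2]`, so it leaves `[0, ∞)` untouched. The value at `0` need not
  -- vanish, so `g` needs no zero mean.
  let θ₀ : ℝ → ℝ := fun t => ∫ s in R..t, g s
  have hd : ∀ t, HasDerivAt θ₀ (g t) t := fun t =>
    intervalIntegral.integral_hasDerivAt_right (hg.continuous.intervalIntegrable _ _)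
      (hg.continuous.stronglyMeasurableAtFilter _ _) hg.continuous.continuousAt
  have hs : ContDiff ℝ ∞ θ₀ := by
    rw [contDiff_infty_iff_deriv]
    refine ⟨fun t => (hd t).differentiableAt, ?_⟩
    rwa [show deriv θ₀ = g from funext fun t => (hd t).deriv]
  have hθR : ∀ t, R ≤ t → θ₀ t = 0 := by
    intro t ht
    refine intervalIntegral.integral_zero_ae (Eventually.of_forall fun s hs => hR s ?_)
    rw [uIoc_of_le ht] at hs
    exact hs.1.le
  let χ : ℝ → ℝ := fun t => Real.smoothTransition (t + 2)
  have hχ : ContDiff ℝ ∞ χ :=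
    Real.smoothTransition.contDiff.comp (contDiff_id.add contDiff_const)
  refine ⟨fun t => χ t * θ₀ t, hχ.mul hs, ?_, fun t ht => ?_⟩
  · refine HasCompactSupport.intro (isCompact_Icc (a := -2) (b := R)) fun t ht => ?_
    rw [mem_Icc, not_and_or, not_le, not_le] at ht
    rcases ht with h | h
    · have : χ t = 0 := Real.smoothTransition.zero_of_nonpos (by linarith)
      rw [this, zero_mul]
    · rw [hθR t h.le, mul_zero]
  · have he : (fun t => χ t * θ₀ t) =ᶠ[𝓝 t] θ₀ := by
      filter_upwards [Ioi_mem_nhds (show (-1 : ℝ) < t by linarith)] with r hr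
      have : χ r = 1 := Real.smoothTransition.one_of_one_le (by linarith [mem_Ioi.1 hr])
      rw [this, one_mul]
    rw [he.deriv_eq, (hd t).deriv]

/-- A weak solution of `u' = G`, `u(0) = u₀`, tested against a dense set, agrees almost everywhere
with the primitive of `G`. -/
theorem ae_eq_prim_of_weak [CompleteSpace H] {D : Set H} (hD : Dense D) {u G : ℝ → H} {u₀ : H}
    (hu : LocallyIntegrable u timeMeasure) (hG : LocallyIntegrable G volume)
    (h : ∀ x ∈ D, ∀ θ : ℝ → ℝ, ContDiff ℝ ∞ θ → HasCompactSupport θ →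
      ∫ t, (deriv θ t * inner ℝ (u t) x + θ t * inner ℝ (G t) x) ∂timeMeasure
        + θ 0 * inner ℝ u₀ x = 0) :
    ∀ᵐ t ∂timeMeasure, prim u₀ G t = u t := by
  have hGt : LocallyIntegrable G timeMeasure := hG.mono_measure Measure.restrict_le_self
  have hloc : LocallyIntegrable (prim u₀ G) timeMeasure :=
    (continuous_prim hG u₀).locallyIntegrable
  have hsub : LocallyIntegrable (fun t => u t - prim u₀ G t) timeMeasure := hu.sub hloc
  have hzero : ∀ θ : ℝ → ℝ, ContDiff ℝ ∞ θ → HasCompactSupport θ →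
      ∫ t, deriv θ t • (u t - prim u₀ G t) ∂timeMeasure = 0 := by
    intro θ hθ hc
    have hdc : Continuous (deriv θ) := hθ.continuous_deriv (by simp)
    have hi : ∀ {w : ℝ → H}, LocallyIntegrable w timeMeasure →
        Integrable (fun t => deriv θ t • w t) timeMeasure := fun hw =>
      hw.integrable_smul_left_of_hasCompactSupport hdc hc.deriv
    have hiG : Integrable (fun t => θ t • G t) timeMeasure :=
      hGt.integrable_smul_left_of_hasCompactSupport hθ.continuous hc
    set I := ∫ t, deriv θ t • (u t - prim u₀ G t) ∂timeMeasure with hI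
    -- Subtracting the weak identities for `u` and for the primitive cancels both the `G` terms and
    -- the initial terms.
    have hx : ∀ x ∈ D, inner ℝ x I = 0 := by
      intro x hx
      rw [hI, ← integral_inner (hi hsub)]
      have h1 := h x hx θ hθ hc
      have h2 := integral_deriv_mul_prim hG u₀ x hθ hc
      have i1 : Integrable (fun t => deriv θ t * inner ℝ (u t) x + θ t * inner ℝ (G t) x)
          timeMeasure := by
        have := ((innerSL ℝ x).integrable_comp (hi hu)).add ((innerSL ℝ x).integrable_comp hiG)
        refine this.congr (Eventually.of_forall fun t => ?_)
        simp [real_inner_comm]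
      have i2 : Integrable (fun t => deriv θ t * inner ℝ (prim u₀ G t) x
          + θ t * inner ℝ (G t) x) timeMeasure := by
        have := ((innerSL ℝ x).integrable_comp (hi hloc)).add ((innerSL ℝ x).integrable_comp hiG)
        refine this.congr (Eventually.of_forall fun t => ?_)
        simp [real_inner_comm]
      have h3 := integral_sub i1 i2
      rw [show (0 : ℝ) = (-(θ 0 * inner ℝ u₀ x)) - (-(θ 0 * inner ℝ u₀ x)) by ring]
      rw [h2, show ∫ t, (deriv θ t * inner ℝ (u t) x + θ t * inner ℝ (G t) x) ∂timeMeasure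
        = -(θ 0 * inner ℝ u₀ x) by linarith] at h3
      rw [← h3]
      refine integral_congr_ae (Eventually.of_forall fun t => ?_)
      simp only [real_inner_smul_right, inner_sub_right, real_inner_comm x]
      ring
    have hfun : (fun x : H => inner ℝ x I) = fun _ => 0 :=
      Continuous.ext_on hD (by fun_prop) continuous_const hx
    exact inner_self_eq_zero.1 (congrFun hfun I)
  have hae := isOpen_Ioi.ae_eq_zero_of_integral_contDiff_smul_eq_zero (μ := volume)
    (U := Ioi (0 : ℝ)) (f := fun t => u t - prim u₀ G t)
    ((locallyIntegrableOn_of_locallyIntegrable_restrict hsub).mono_set Ioi_subset_Ici_self)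
    fun g hg hc hs => by
      obtain ⟨θ, hθ, hθc, hθg⟩ := exists_antideriv_test hg hc
      rw [← hzero θ hθ hθc, timeMeasure]
      rw [← setIntegral_eq_integral_of_forall_compl_eq_zero (s := Ici (0 : ℝ))]
      · refine setIntegral_congr_fun measurableSet_Ici fun t ht => ?_
        simp only [hθg t ht]
      · intro t ht
        have : t ∉ tsupport g := fun hts => ht (mem_Ici.2 (le_of_lt (hs hts)))
        rw [image_eq_zero_of_notMem_tsupport this, zero_smul]
  rw [timeMeasure, ← restrict_Ioi_eq_restrict_Ici, ae_restrict_iff' measurableSet_Ioi]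
  filter_upwards [hae] with t ht h0
  exact (sub_eq_zero.1 (ht h0)).symm

end Primitive

/-! ### Sobolev functions and their norms -/

theorem MemSob.hasWeakPartial {k : ℕ} {g : L2} (h : MemSob (k + 1) g) (j : Fin 3) :
    HasWeakPartial j g (weakPartial j g) := by
  obtain ⟨d, hd, -⟩ := h j
  rwa [hd.weakPartial_eq]

theorem MemSob.weakPartial {k : ℕ} {g : L2} (h : MemSob (k + 1) g) (j : Fin 3) :
    MemSob k (weakPartial j g) := by
  obtain ⟨d, hd, hk⟩ := h j
  rwa [hd.weakPartial_eq]

theorem memSob_one_of {g : L2} {d : Fin 3 → L2} (h : ∀ j, HasWeakPartial j g (d j)) :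
    MemSob 1 g := fun j => ⟨d j, h j, trivial⟩

theorem homSq_one (g : L2) : homSq 1 g = ∑ j, ‖weakPartial j g‖ ^ 2 := rfl

theorem homSq_two (g : L2) :
    homSq 2 g = ∑ j, ∑ k, ‖weakPartial k (weakPartial j g)‖ ^ 2 := rfl

theorem homSq_nonneg : ∀ (k : ℕ) (g : L2), 0 ≤ homSq k g
  | 0, _ => sq_nonneg _
  | k + 1, _ => Finset.sum_nonneg fun _ _ => homSq_nonneg k _

theorem vhomSq_nonneg (k : ℕ) (u : VL2) : 0 ≤ vhomSq k u :=
  Finset.sum_nonneg fun _ _ => homSq_nonneg k _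

theorem homSq_le_vhomSq (k : ℕ) (u : VL2) (i : Fin 3) : homSq k (u i) ≤ vhomSq k u :=
  Finset.single_le_sum (f := fun i => homSq k (u i)) (fun _ _ => homSq_nonneg k _)
    (Finset.mem_univ i)

theorem energySq_nonneg (α : ℝ) (u : VL2) : 0 ≤ energySq α u :=
  add_nonneg (vhomSq_nonneg _ _) (mul_nonneg (sq_nonneg _) (vhomSq_nonneg _ _))

/-- The Laplacian of an `H²` function. -/
def lapL2 (g : L2) : L2 := ∑ j, weakPartial j (weakPartial j g)

/-- Mixed weak derivatives commute. -/
theorem hasWeakPartial_comm {j k : Fin 3} {g a b c e : L2} (ha : HasWeakPartial j g a)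
    (hb : HasWeakPartial k a b) (hc : HasWeakPartial k g c) (he : HasWeakPartial j c e) :
    b = e := by
  refine eq_of_inner_test fun φ hφ => ?_
  have h1 := hasWeakPartial_iff.1 ha _ (hφ.pd k)
  have h2 := hasWeakPartial_iff.1 hb _ hφ
  have h3 := hasWeakPartial_iff.1 hc _ (hφ.pd j)
  have h4 := hasWeakPartial_iff.1 he _ hφ
  rw [toL2_congr ((hφ.pd k).pd j) ((hφ.pd j).pd k) (pd_comm hφ j k)] at h1
  linarith

/-- Two integrations by parts, `∫ ∂ⱼⱼg ∂ₖₖg = ∫ |∂ⱼₖg|²`. The intermediate step involves a third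
derivative, which mollification provides. -/
theorem inner_pure_second_derivatives {j k : Fin 3} {gj gk gjj gkk gjk : L2}
    (hjj : HasWeakPartial j gj gjj)
    (hkk : HasWeakPartial k gk gkk) (hjk : HasWeakPartial k gj gjk)
    (hkj : HasWeakPartial j gk gjk) : inner ℝ gjj gkk = ‖gjk‖ ^ 2 := by
  have key : ∀ n, inner ℝ (smooth n gjj) (smooth n gkk) = ‖smooth n gjk‖ ^ 2 := by
    intro n
    have h1 := (hjj.smooth n).inner_eq_neg (hasWeakPartial_smooth n j gkk)
    have h2 : HasWeakPartial k (dsmooth n j gk) (dsmooth n j gkk) := hkk.moll _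
    rw [hkj.dsmooth_eq n] at h2
    have h3 := (hjk.smooth n).inner_eq_neg h2
    rw [real_inner_self_eq_norm_sq] at h3
    linarith
  have h1 : Tendsto (fun n => inner ℝ (smooth n gjj) (smooth n gkk)) atTop
      (𝓝 (inner ℝ gjj gkk)) := (tendsto_smooth gjj).inner (tendsto_smooth gkk)
  have h2 : Tendsto (fun n => ‖smooth n gjk‖ ^ 2) atTop (𝓝 (‖gjk‖ ^ 2)) :=
    (tendsto_smooth gjk).norm.pow 2
  simp only [key] at h1
  exact tendsto_nhds_unique h1 h2

/-- Expanding the square, each product of pure second derivatives becomes a squared mixed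
derivative. Thus pairing with `Δu` produces exactly the `Ḣ²` dissipation. -/
theorem norm_lapL2_sq {g : L2} (hg : MemSob 2 g) : ‖lapL2 g‖ ^ 2 = homSq 2 g := by
  rw [homSq_two, ← real_inner_self_eq_norm_sq, lapL2, sum_inner]
  refine Finset.sum_congr rfl fun j _ => ?_
  rw [inner_sum]
  refine Finset.sum_congr rfl fun k _ => ?_
  have hj := hg.hasWeakPartial j
  have hk := hg.hasWeakPartial k
  have hjj := (hg.weakPartial j).hasWeakPartial j
  have hjk := (hg.weakPartial j).hasWeakPartial k
  have hkj := (hg.weakPartial k).hasWeakPartial j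
  have hkk := (hg.weakPartial k).hasWeakPartial k
  rw [← hasWeakPartial_comm hj hjk hk hkj] at hkj
  exact inner_pure_second_derivatives hjj hkk hjk hkj

theorem inner_lapL2 {g h : L2} (hg : MemSob 1 g) (hh : MemSob 2 h) :
    inner ℝ g (lapL2 h) = -∑ j, inner ℝ (weakPartial j g) (weakPartial j h) := by
  rw [lapL2, inner_sum, ← Finset.sum_neg_distrib]
  exact Finset.sum_congr rfl fun j _ =>
    (hg.hasWeakPartial j).inner_eq_neg ((hh.weakPartial j).hasWeakPartial j)

theorem inner_lapL2_toL2 {g : L2} (hg : MemSob 2 g) {φ : E3 → ℝ} (hφ : IsTest φ) :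
    inner ℝ (lapL2 g) hφ.toL2 = inner ℝ g hφ.lap.toL2 := by
  rw [lapL2, sum_inner, toL2_lap hφ, inner_sum]
  refine Finset.sum_congr rfl fun j _ => ?_
  have h1 := hasWeakPartial_iff.1 (hg.hasWeakPartial j) _ (hφ.pd j)
  have h2 := hasWeakPartial_iff.1 ((hg.weakPartial j).hasWeakPartial j) _ hφ
  linarith

theorem MemSob.one_of_two {g : L2} (hg : MemSob 2 g) : MemSob 1 g :=
  memSob_one_of fun j => hg.hasWeakPartial j

/-- The Laplacian moves onto the test function and commutes with its gradient. This is what removes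
the pressure from the `α²` part of the energy balance. -/
theorem IsDivFree.lapL2 {u : VL2} (hu : IsDivFree u) (h2 : ∀ i, MemSob 2 (u i)) :
    IsDivFree fun i => lapL2 (u i) := by
  refine isDivFree_iff.2 fun φ hφ => ?_
  have h := isDivFree_iff.1 hu _ hφ.lap
  rw [← h]
  refine Finset.sum_congr rfl fun i _ => ?_
  rw [inner_lapL2_toL2 (h2 i) (hφ.pd i),
    toL2_congr (hφ.pd i).lap (hφ.lap.pd i) (lap_pd hφ i)]

theorem sobSize_sq_le {u : VL2} {M : ℝ} (hM : vhomSq 0 u + vhomSq 1 u ≤ M) (i : Fin 3) :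
    sobSize (u i) (fun j => weakPartial j (u i)) ≤ 4 * (1 + M) := by
  have h0 : ‖u i‖ ^ 2 ≤ vhomSq 0 u := homSq_le_vhomSq 0 u i
  have h1 : ∑ j, ‖weakPartial j (u i)‖ ^ 2 ≤ vhomSq 1 u := homSq_le_vhomSq 1 u i
  unfold sobSize
  rw [Fin.sum_univ_three] at h1 ⊢
  nlinarith [sq_nonneg (‖u i‖ - 1), sq_nonneg (‖weakPartial 0 (u i)‖ - 1),
    sq_nonneg (‖weakPartial 1 (u i)‖ - 1), sq_nonneg (‖weakPartial 2 (u i)‖ - 1),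
    norm_nonneg (u i), vhomSq_nonneg 0 u, vhomSq_nonneg 1 u]

/-! ### The time derivative prescribed by the equation -/

/-- The weak form of the right-hand side of the `i`-th equation, tested with `φ - α² Δ φ`. -/
def weakRhs (ν α β : ℝ) (f u : VL2) (p : L2) (i : Fin 3) (φ : E3 → ℝ) : ℝ :=
  (∑ j, ∫ x, u i x * u j x * pd j φ x) + ν * (∫ x, u i x * lap (helm α φ) x)
    + (∫ x, p x * pd i (helm α φ) x) + (∫ x, f i x * helm α φ x)
    - β * ∫ x, u i x * helm α φ x

/-- The `𝓗¹_α` inner product of two fields. -/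
def energyInner (α : ℝ) (f u : VL2) : ℝ :=
  ∑ i, (inner ℝ (f i) (u i) + α ^ 2 * ∑ j, inner ℝ (weakPartial j (f i)) (weakPartial j (u i)))

theorem energyInner_self (α : ℝ) (u : VL2) : energyInner α u u = energySq α u := by
  simp only [energyInner, real_inner_self_eq_norm_sq, Finset.sum_add_distrib, ← Finset.mul_sum]
  rfl

theorem sq_norm_add_five_le {a b c d e : ℝ} {F : ℝ} (h0 : 0 ≤ F) (h : F ≤ a + b + c + d + e) :
    F ^ 2 ≤ 5 * (a ^ 2 + b ^ 2 + c ^ 2 + d ^ 2 + e ^ 2) := by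
  have h1 : F ^ 2 ≤ (a + b + c + d + e) ^ 2 := pow_le_pow_left₀ h0 h 2
  nlinarith [sq_nonneg (a - b), sq_nonneg (a - c), sq_nonneg (a - d), sq_nonneg (a - e),
    sq_nonneg (b - c), sq_nonneg (b - d), sq_nonneg (b - e), sq_nonneg (c - d),
    sq_nonneg (c - e), sq_nonneg (d - e)]

/-- The time derivative at a fixed time is `F = N + νΔu - ∇p + f - βu`, where `N` is the `L²`
function representing `-div (u ⊗ u)_α`. The first conclusion identifies it with the weak form, the
second gives square integrability in time, and the third is the formal energy balance. `K` depends
on `u` only through `M`, so one constant serves almost all times. -/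
theorem exists_force {ν α β : ℝ} (hα : 0 < α) {f : VL2} (hf : ∀ i, MemSob 1 (f i)) (M : ℝ) :
    ∃ K : ℝ, 0 ≤ K ∧ ∀ (u : VL2) (p : L2), (∀ i, MemSob 2 (u i)) → IsDivFree u →
      vhomSq 0 u + vhomSq 1 u ≤ M → MemSob 3 p →
      ∃ F : VL2,
        (∀ i (φ : E3 → ℝ) (hφ : IsTest φ),
          inner ℝ (F i) (hφ.helm α).toL2 = weakRhs ν α β f u p i φ) ∧
        (∀ i, ‖F i‖ ^ 2 ≤ K * (1 + vhomSq 2 u + ∑ k ∈ Finset.range 4, homSq k p)) ∧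
        ∑ i, inner ℝ (F i) (u i - α ^ 2 • lapL2 (u i))
          = -ν * (vhomSq 1 u + α ^ 2 * vhomSq 2 u) - β * energySq α u + energyInner α f u := by
  set A : ℝ := α⁻¹ * (3 * (mulConst * (4 * (1 + M) * (4 * (1 + M))))) with hA
  set B : ℝ := ∑ i, ‖f i‖ with hB
  refine ⟨5 * (A ^ 2 + ν ^ 2 + 1 + B ^ 2 + β ^ 2 * |M|), by positivity,
    fun u p hu2 hdiv hM hp => ?_⟩
  have hu1 : ∀ i, MemSob 1 (u i) := fun i => (hu2 i).one_of_two
  have hgrad : ∀ i j, HasWeakPartial j (u i) (weakPartial j (u i)) := fun i j =>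
    (hu1 i).hasWeakPartial j
  have hq : ∀ i j, ∃ q : L2, q =ᵐ[volume] fun x => u i x * u j x := fun i j =>
    exists_ae_eq_mul (hgrad i) (hgrad j)
  choose q hq using hq
  have hN := fun i => exists_filtered_div hα (q i)
  choose N hNn hN using hN
  have hM0 : 0 ≤ M := (add_nonneg (vhomSq_nonneg 0 u) (vhomSq_nonneg 1 u)).trans hM
  have hNA : ∀ i, ‖N i‖ ≤ A := by
    intro i
    refine (hNn i).trans ?_
    rw [hA]
    refine mul_le_mul_of_nonneg_left ?_ (inv_nonneg.2 hα.le)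
    have : ∀ j, ‖q i j‖ ≤ mulConst * (4 * (1 + M) * (4 * (1 + M))) := fun j => by
      refine (norm_le_of_ae_eq_mul (hgrad i) (hgrad j) (hq i j)).trans ?_
      refine mul_le_mul_of_nonneg_left ?_ mulConst_nonneg
      exact mul_le_mul (sobSize_sq_le hM i) (sobSize_sq_le hM j) (sobSize_nonneg _ _)
        (by positivity)
    rw [Fin.sum_univ_three]
    linarith [this 0, this 1, this 2]
  clear_value A
  refine ⟨fun i => N i + ν • lapL2 (u i) - weakPartial i p + f i - β • u i, ?_, ?_, ?_⟩
  · intro i φ hφ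
    have hh := hφ.helm α
    rw [inner_sub_left, inner_add_left, inner_sub_left, inner_add_left, real_inner_smul_left,
      real_inner_smul_left, hN i φ hφ, inner_lapL2_toL2 (hu2 i) hh]
    have h1 := hasWeakPartial_iff.1 (hp.hasWeakPartial i) _ hh
    have h2 : ∀ j, inner ℝ (q i j) (hφ.pd j).toL2 = ∫ x, u i x * u j x * pd j φ x := by
      intro j
      rw [inner_toL2]
      refine integral_congr_ae ?_
      filter_upwards [hq i j] with x hx
      rw [hx]
    simp only [h2]
    rw [weakRhs, ← inner_toL2 _ hh.lap, ← inner_toL2 _ (hh.pd i), ← inner_toL2 _ hh,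
      ← inner_toL2 _ hh, h1]
    ring
  · intro i
    have h5 : ‖N i + ν • lapL2 (u i) - weakPartial i p + f i - β • u i‖
        ≤ A + |ν| * ‖lapL2 (u i)‖ + ‖weakPartial i p‖ + B + |β| * ‖u i‖ := by
      have hfi : ‖f i‖ ≤ B :=
        Finset.single_le_sum (f := fun i => ‖f i‖) (fun _ _ => norm_nonneg _) (Finset.mem_univ i)
      have a1 := norm_sub_le (N i + ν • lapL2 (u i) - weakPartial i p + f i) (β • u i)
      have a2 := norm_add_le (N i + ν • lapL2 (u i) - weakPartial i p) (f i)
      have a3 := norm_sub_le (N i + ν • lapL2 (u i)) (weakPartial i p)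
      have a4 := norm_add_le (N i) (ν • lapL2 (u i))
      rw [norm_smul, Real.norm_eq_abs] at a1 a4
      linarith [hNA i]
    have h6 := sq_norm_add_five_le (norm_nonneg _) h5
    refine h6.trans ?_
    have b1 : ‖lapL2 (u i)‖ ^ 2 ≤ vhomSq 2 u := by
      rw [norm_lapL2_sq (hu2 i)]; exact homSq_le_vhomSq 2 u i
    have b2 : ‖weakPartial i p‖ ^ 2 ≤ ∑ k ∈ Finset.range 4, homSq k p := by
      have c1 : ‖weakPartial i p‖ ^ 2 ≤ homSq 1 p :=
        Finset.single_le_sum (f := fun j => ‖weakPartial j p‖ ^ 2) (fun _ _ => sq_nonneg _)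
          (Finset.mem_univ i)
      exact c1.trans (Finset.single_le_sum (f := fun k => homSq k p)
        (fun k _ => homSq_nonneg k p) (by simp))
    have b3 : ‖u i‖ ^ 2 ≤ |M| := by
      have c0 : ‖u i‖ ^ 2 ≤ vhomSq 0 u := homSq_le_vhomSq 0 u i
      linarith [vhomSq_nonneg 1 u, le_abs_self M]
    set P := ∑ k ∈ Finset.range 4, homSq k p
    set V := vhomSq 2 u
    have hV : 0 ≤ V := vhomSq_nonneg 2 u
    have hP : 0 ≤ P := Finset.sum_nonneg fun k _ => homSq_nonneg k p
    rw [mul_pow, mul_pow, sq_abs, sq_abs, mul_assoc]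
    refine mul_le_mul_of_nonneg_left ?_ (by norm_num)
    have d1 : ν ^ 2 * ‖lapL2 (u i)‖ ^ 2 ≤ ν ^ 2 * V := by gcongr
    have d2 : β ^ 2 * ‖u i‖ ^ 2 ≤ β ^ 2 * |M| := by gcongr
    have d3 : 0 ≤ (A ^ 2 + B ^ 2 + β ^ 2 * |M|) * (V + P) := by positivity
    have d4 : 0 ≤ ν ^ 2 * (1 + P) + (1 + V) := by positivity
    nlinarith [d1, d2, d3, d4, b2]
  -- Pairing with `u - α²Δu` undoes the filter; the trilinear cancellation then holds for each
  -- component separately, with `g = u i`.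
  · have t1 : ∀ i, inner ℝ (N i) (u i - α ^ 2 • lapL2 (u i)) = 0 := by
      intro i
      rw [lapL2, inner_filtered_div (hN i) (hgrad i)
        (fun j => ((hu2 i).weakPartial j).hasWeakPartial j)]
      exact hdiv.sum_inner_mul_eq_zero hgrad (hgrad i) (hq i)
    have t2 : ∀ i, inner ℝ (lapL2 (u i)) (u i - α ^ 2 • lapL2 (u i))
        = -(homSq 1 (u i) + α ^ 2 * homSq 2 (u i)) := by
      intro i
      rw [inner_sub_right, real_inner_smul_right, real_inner_self_eq_norm_sq,
        norm_lapL2_sq (hu2 i), real_inner_comm, inner_lapL2 (hu1 i) (hu2 i)]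
      simp only [real_inner_self_eq_norm_sq, homSq_one]
      ring
    have t3 : ∑ i, inner ℝ (weakPartial i p) (u i - α ^ 2 • lapL2 (u i)) = 0 := by
      have c1 := hdiv.sum_inner_eq_zero (fun j => hp.hasWeakPartial j)
      have c2 := (hdiv.lapL2 hu2).sum_inner_eq_zero (fun j => hp.hasWeakPartial j)
      simp only [inner_sub_right, real_inner_smul_right, Finset.sum_sub_distrib,
        ← Finset.mul_sum]
      simp only [real_inner_comm (u _), real_inner_comm (lapL2 _), c1, c2]
      ring
    have t4 : ∀ g : VL2, (∀ i, MemSob 1 (g i)) →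
        ∑ i, inner ℝ (g i) (u i - α ^ 2 • lapL2 (u i)) = energyInner α g u := by
      intro g hg
      refine Finset.sum_congr rfl fun i _ => ?_
      rw [inner_sub_right, real_inner_smul_right, inner_lapL2 (hg i) (hu2 i)]
      ring
    have t5 := t4 u hu1
    rw [energyInner_self] at t5
    simp only [inner_add_left, inner_sub_left, real_inner_smul_left, Finset.sum_add_distrib,
      Finset.sum_sub_distrib, t1, t2, t3, t4 f hf]
    rw [← Finset.mul_sum, ← Finset.mul_sum]
    simp only [inner_sub_right] at t5 ⊢
    rw [t5, Finset.sum_neg_distrib, Finset.sum_add_distrib, ← Finset.mul_sum]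
    simp only [vhomSq, Finset.sum_const_zero]
    ring

/-! ### Testing the equation with `θ(t) (φ - α² Δ φ)(x)` -/

theorem pd_helm {φ : E3 → ℝ} (hφ : IsTest φ) (α : ℝ) (j : Fin 3) :
    pd j (helm α φ) = helm α (pd j φ) := by
  unfold helm
  rw [pd_sub hφ (hφ.lap.const_mul _), pd_const_mul hφ.lap, lap_pd hφ]

theorem lap_const_mul {φ : E3 → ℝ} (hφ : IsTest φ) (c : ℝ) :
    lap (fun x => c * φ x) = fun x => c * lap φ x := by
  funext x
  simp only [lap, pd_const_mul hφ, pd_const_mul (hφ.pd _), Finset.mul_sum]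

/-- Multiplication of `L²` functions by a test function. -/
def mulTest {χ : E3 → ℝ} (hχ : IsTest χ) : L2 →L[ℝ] L2 :=
  (ContinuousLinearMap.mul ℝ ℝ).holderL volume ⊤ 2 2 ((hχ.memLp (p := ⊤)).toLp χ)

/-- Writing the quadratic term with a bounded operator makes it continuous in the pair of `L²`
functions, hence measurable along a measurable curve. -/
theorem integral_mul_mul_test (g h : L2) {χ : E3 → ℝ} (hχ : IsTest χ) :
    ∫ x, g x * h x * χ x = inner ℝ g (mulTest hχ h) := by
  rw [inner_eq_integral]
  refine integral_congr_ae ?_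
  have h1 : mulTest hχ h =ᵐ[volume] fun x => ((hχ.memLp (p := ⊤)).toLp χ) x * h x :=
    ContinuousLinearMap.coeFn_holder (r := 2) (ContinuousLinearMap.mul ℝ ℝ)
      ((hχ.memLp (p := ⊤)).toLp χ) h
  filter_upwards [h1, (hχ.memLp (p := ⊤) : MemLp χ ⊤ volume).coeFn_toLp] with x a b
  rw [a, b]; ring

theorem aestronglyMeasurable_weakRhs {ν α β : ℝ} {f : VL2} {u : ℝ → VL2} {p : ℝ → L2}
    (hu : AEStronglyMeasurable u timeMeasure) (hp : AEStronglyMeasurable p timeMeasure)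
    (i : Fin 3) {φ : E3 → ℝ} (hφ : IsTest φ) :
    AEStronglyMeasurable (fun t => weakRhs ν α β f (u t) (p t) i φ) timeMeasure := by
  have hh := hφ.helm α
  have hui : ∀ i, AEStronglyMeasurable (fun t => u t i) timeMeasure := fun i =>
    (continuous_apply i).comp_aestronglyMeasurable hu
  have hin : ∀ {g : ℝ → L2}, AEStronglyMeasurable g timeMeasure → ∀ x : L2,
      AEStronglyMeasurable (fun t => inner ℝ (g t) x) timeMeasure := fun hg x =>
    hg.inner aestronglyMeasurable_const
  simp only [weakRhs, integral_mul_mul_test _ _ (hφ.pd _), ← inner_toL2 _ hh.lap,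
    ← inner_toL2 _ (hh.pd i), ← inner_toL2 _ hh]
  refine ((((Finset.aestronglyMeasurable_fun_sum _ fun j _ => ?_).add
    ((hin (hui i) _).const_mul ν)).add (hin hp _)).add aestronglyMeasurable_const).sub
    ((hin (hui i) _).const_mul β)
  exact (hui i).inner ((mulTest (hφ.pd j)).continuous.comp_aestronglyMeasurable (hui j))

/-- Derivatives commute with the Helmholtz operator, so `w` is paired with `∂ⱼφ - α²Δ∂ⱼφ`, and the
filter equation replaces it by `u i * u j`. The filtered tensor disappears from the equation. -/
theorem integral_weak_form {ν α β : ℝ} {f u : VL2} {p : L2} {i : Fin 3} {w : Fin 3 → L2}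
    (hw : ∀ j, IsHelmholtzFilter α (fun x => u i x * u j x) (w j)) {φ : E3 → ℝ} (hφ : IsTest φ)
    {θ : ℝ → ℝ} (hθ : Differentiable ℝ θ) (t : ℝ) :
    ∫ x, (u i x * deriv (fun s => θ s * helm α φ x) t
            + ∑ j : Fin 3, w j x * pd j (fun y => θ t * helm α φ y) x
            + ν * (u i x * lap (fun y => θ t * helm α φ y) x)
            + p x * pd i (fun y => θ t * helm α φ y) x
            + f i x * (θ t * helm α φ x)
            - β * (u i x * (θ t * helm α φ x)))
      = deriv θ t * inner ℝ (u i) (hφ.helm α).toL2 + θ t * weakRhs ν α β f u p i φ := by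
  have hh := hφ.helm α
  have hint : ∀ x, (u i x * deriv (fun s => θ s * helm α φ x) t
            + ∑ j : Fin 3, w j x * pd j (fun y => θ t * helm α φ y) x
            + ν * (u i x * lap (fun y => θ t * helm α φ y) x)
            + p x * pd i (fun y => θ t * helm α φ y) x
            + f i x * (θ t * helm α φ x)
            - β * (u i x * (θ t * helm α φ x)))
      = deriv θ t * (u i x * helm α φ x) + θ t * (∑ j, w j x * pd j (helm α φ) x)
        + θ t * ν * (u i x * lap (helm α φ) x) + θ t * (p x * pd i (helm α φ) x)
        + θ t * (f i x * helm α φ x) - θ t * β * (u i x * helm α φ x) := by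
    intro x
    rw [deriv_mul_const (hθ t), lap_const_mul hh]
    simp only [pd_const_mul hh]
    rw [Finset.mul_sum, Finset.sum_congr rfl fun j _ => mul_left_comm (w j x) (θ t) _]
    ring
  simp only [hint]
  have i1 := (integrable_mul_test (u i) hh).const_mul (deriv θ t)
  have i2 : Integrable (fun x => θ t * ∑ j, w j x * pd j (helm α φ) x) :=
    (integrable_finsetSum _ fun j _ => integrable_mul_test (w j) (hh.pd j)).const_mul _
  have i3 := (integrable_mul_test (u i) hh.lap).const_mul (θ t * ν)
  have i4 := (integrable_mul_test p (hh.pd i)).const_mul (θ t)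
  have i5 := (integrable_mul_test (f i) hh).const_mul (θ t)
  have i6 := (integrable_mul_test (u i) hh).const_mul (θ t * β)
  have i12 := i1.fun_add i2
  have i13 := i12.fun_add i3
  have i14 := i13.fun_add i4
  rw [integral_sub (i14.fun_add i5) i6, integral_add i14 i5, integral_add i13 i4,
    integral_add i12 i3, integral_add i1 i2]
  simp only [integral_const_mul]
  rw [integral_finsetSum _ fun j _ => integrable_mul_test (w j) (hh.pd j)]
  have hwj : ∀ j, ∫ x, w j x * pd j (helm α φ) x = ∫ x, u i x * u j x * pd j φ x := by
    intro j
    rw [← hw j _ (hφ.pd j), pd_helm hφ]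
    rfl
  simp only [hwj]
  rw [weakRhs, inner_toL2]
  ring

theorem locallyIntegrable_indicator_Ici {E : Type*} [NormedAddCommGroup E] {g : ℝ → E}
    (h : ∀ T : ℝ, IntegrableOn g (Icc 0 T)) :
    LocallyIntegrable ((Ici (0 : ℝ)).indicator g) volume := by
  rw [locallyIntegrable_iff]
  intro k hk
  obtain ⟨R, hR⟩ := hk.isBounded.subset_closedBall 0
  have h1 : IntegrableOn ((Icc (0 : ℝ) R).indicator g) k :=
    ((integrable_indicator_iff measurableSet_Icc).2 (h R)).integrableOn
  refine h1.congr_fun (fun t ht => ?_) hk.measurableSet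
  have htR : t ≤ R := by
    have := hR ht
    rw [Metric.mem_closedBall, dist_zero_right, Real.norm_eq_abs] at this
    exact (le_abs_self t).trans this
  by_cases h0 : 0 ≤ t
  · rw [indicator_of_mem (mem_Icc.2 ⟨h0, htR⟩), indicator_of_mem (mem_Ici.2 h0)]
  · rw [indicator_of_notMem (fun h => h0 h.1), indicator_of_notMem (fun h => h0 (mem_Ici.1 h))]

theorem ae_Icc_of_ae_timeMeasure {P : ℝ → Prop} (h : ∀ᵐ t ∂timeMeasure, P t) (T : ℝ) :
    ∀ᵐ t ∂volume.restrict (Icc 0 T), P t :=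
  ae_mono (Measure.restrict_mono Icc_subset_Ici_self le_rfl) h

/-- A weak solution solves an ordinary differential equation in `L²`, and the power of its
right-hand side is given by the formal energy balance. -/
theorem IsWeakSolution.exists_evolution {ν α β : ℝ} (hα : 0 < α) {u₀ f : VL2}
    (hf : ∀ i, MemSob 1 (f i)) {u : ℝ → VL2} {p : ℝ → L2}
    (hup : IsWeakSolution ν α β f u₀ u p) :
    ∃ G : Fin 3 → ℝ → L2, (∀ i, LocallyIntegrable (G i) volume) ∧
      (∀ i T, IntegrableOn (fun t => ‖G i t‖ ^ 2) (Icc 0 T)) ∧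
      (∀ᵐ t ∂timeMeasure, ∀ i, prim (u₀ i) (G i) t = u t i) ∧
      ∀ᵐ t ∂timeMeasure, ∑ i, inner ℝ (G i t) (u t i - α ^ 2 • lapL2 (u t i))
          = -ν * (vhomSq 1 (u t) + α ^ 2 * vhomSq 2 (u t)) - β * energySq α (u t)
            + energyInner α f (u t) := by
  obtain ⟨M, hM⟩ := hup.energySpace.bound
  obtain ⟨K, hK0, hK⟩ := exists_force (ν := ν) (β := β) hα hf M
  obtain ⟨w, hw, heq⟩ := hup.equation
  -- The force is chosen separately at each time, with `0` at the exceptional ones. No measurable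
  -- selection is needed: pairings with the dense range of the Helmholtz operator are explicit
  -- measurable functions of time.
  have hgood : ∀ t, ∃ F : VL2, (∀ i, MemSob 2 (u t i)) → IsDivFree (u t) →
      vhomSq 0 (u t) + vhomSq 1 (u t) ≤ M → MemSob 3 (p t) →
        (∀ i (φ : E3 → ℝ) (hφ : IsTest φ),
          inner ℝ (F i) (hφ.helm α).toL2 = weakRhs ν α β f (u t) (p t) i φ) ∧
        (∀ i, ‖F i‖ ^ 2 ≤ K * (1 + vhomSq 2 (u t) + ∑ k ∈ Finset.range 4, homSq k (p t))) ∧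
        ∑ i, inner ℝ (F i) (u t i - α ^ 2 • lapL2 (u t i))
          = -ν * (vhomSq 1 (u t) + α ^ 2 * vhomSq 2 (u t)) - β * energySq α (u t)
            + energyInner α f (u t) := by
    intro t
    by_cases h : (∀ i, MemSob 2 (u t i)) ∧ IsDivFree (u t) ∧
        vhomSq 0 (u t) + vhomSq 1 (u t) ≤ M ∧ MemSob 3 (p t)
    · obtain ⟨F, hF⟩ := hK (u t) (p t) h.1 h.2.1 h.2.2.1 h.2.2.2
      exact ⟨F, fun _ _ _ _ => hF⟩
    · exact ⟨0, fun a b c d => absurd ⟨a, b, c, d⟩ h⟩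
  choose F hF using hgood
  have hae : ∀ᵐ t ∂timeMeasure,
        (∀ i (φ : E3 → ℝ) (hφ : IsTest φ),
          inner ℝ (F t i) (hφ.helm α).toL2 = weakRhs ν α β f (u t) (p t) i φ) ∧
        (∀ i, ‖F t i‖ ^ 2 ≤ K * (1 + vhomSq 2 (u t) + ∑ k ∈ Finset.range 4, homSq k (p t))) ∧
        ∑ i, inner ℝ (F t i) (u t i - α ^ 2 • lapL2 (u t i))
          = -ν * (vhomSq 1 (u t) + α ^ 2 * vhomSq 2 (u t)) - β * energySq α (u t)
            + energyInner α f (u t) := by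
    filter_upwards [hup.energySpace.memH2, hup.divFree, hM, hup.pressureSpace.memH3]
      with t a b c d
    exact hF t a b c d
  have hFmeas : ∀ i, AEStronglyMeasurable (fun t => F t i) timeMeasure := by
    intro i
    refine aestronglyMeasurable_of_inner (dense_range_testHelm α) ?_
    rintro _ ⟨⟨φ, hφ⟩, rfl⟩
    have hφ' : IsTest φ := hφ
    rw [testHelm_apply α hφ']
    refine (aestronglyMeasurable_weakRhs (ν := ν) (α := α) (β := β) (f := f)
      hup.energySpace.meas hup.pressureSpace.meas i hφ').congr ?_
    filter_upwards [hae] with t ht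
    exact (ht.1 i φ hφ').symm
  have hFsq : ∀ i T, IntegrableOn (fun t => ‖F t i‖ ^ 2) (Icc 0 T) := by
    intro i T
    have hb : IntegrableOn (fun t => K * (1 + vhomSq 2 (u t)
        + ∑ k ∈ Finset.range 4, homSq k (p t))) (Icc 0 T) :=
      Integrable.const_mul (((integrableOn_const (by simp)).add
        (hup.energySpace.sqInt T)).add (hup.pressureSpace.sqInt T)) K
    refine Integrable.mono' hb ?_ ?_
    · exact ((hFmeas i).mono_measure
        (Measure.restrict_mono Icc_subset_Ici_self le_rfl)).norm.pow 2
    · filter_upwards [ae_Icc_of_ae_timeMeasure hae T] with t ht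
      rw [Real.norm_of_nonneg (sq_nonneg _)]
      exact ht.2.1 i
  have hFint : ∀ i T, IntegrableOn (fun t => F t i) (Icc 0 T) := by
    intro i T
    have hb : IntegrableOn (fun t => 1 + ‖F t i‖ ^ 2) (Icc 0 T) :=
      (integrableOn_const (by simp)).add (hFsq i T)
    refine Integrable.mono' hb ((hFmeas i).mono_measure
        (Measure.restrict_mono Icc_subset_Ici_self le_rfl)) (Eventually.of_forall fun t => ?_)
    nlinarith [sq_nonneg (‖F t i‖ - 1)]
  -- Extension by zero to negative times makes the primitive continuous on the whole line.
  let G : Fin 3 → ℝ → L2 := fun i => (Ici (0 : ℝ)).indicator fun t => F t i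
  have hGF : ∀ i t, 0 ≤ t → G i t = F t i := fun i t ht => indicator_of_mem (mem_Ici.2 ht) _
  have hpos : ∀ᵐ t ∂timeMeasure, 0 ≤ t := ae_restrict_mem measurableSet_Ici
  have hGloc : ∀ i, LocallyIntegrable (G i) volume := fun i =>
    locallyIntegrable_indicator_Ici (hFint i)
  have huloc : ∀ i, LocallyIntegrable (fun t => u t i) timeMeasure := by
    intro i
    refine MemLp.locallyIntegrable (p := ⊤) ?_ le_top
    refine memLp_top_of_bound
      ((continuous_apply i).comp_aestronglyMeasurable hup.energySpace.meas) (1 + M) ?_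
    filter_upwards [hM] with t ht
    have h0 : ‖u t i‖ ^ 2 ≤ vhomSq 0 (u t) := homSq_le_vhomSq 0 (u t) i
    nlinarith [sq_nonneg (‖u t i‖ - 1), vhomSq_nonneg 1 (u t), norm_nonneg (u t i)]
  refine ⟨G, hGloc, fun i T => ?_, ?_, ?_⟩
  · refine (hFsq i T).congr_fun (fun t ht => ?_) measurableSet_Icc
    simp only [hGF i t ht.1]
  · rw [ae_all_iff]
    intro i
    refine ae_eq_prim_of_weak (dense_range_testHelm α) (huloc i) (hGloc i) ?_
    rintro _ ⟨⟨φ, hφ⟩, rfl⟩ θ hθ hθc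
    have hφ' : IsTest φ := hφ
    have hh := hφ'.helm α
    rw [testHelm_apply α hφ']
    have h := heq i (fun q => θ q.1 * helm α φ q.2)
      ((hθ.comp contDiff_fst).mul (hh.1.comp contDiff_snd)) (by
        refine HasCompactSupport.intro (hθc.isCompact.prod hh.2.isCompact) ?_
        rintro ⟨t, x⟩ htx
        rw [Set.mem_prod, not_and_or] at htx
        rcases htx with h | h
        · simp [image_eq_zero_of_notMem_tsupport h]
        · simp [image_eq_zero_of_notMem_tsupport h])
    refine Eq.trans ?_ h
    congr 1
    · refine integral_congr_ae ?_
      filter_upwards [hae, hw, hpos] with t ht hwt h0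
      rw [hGF i t h0, ht.1 i φ hφ']
      exact (integral_weak_form (hwt i) hφ' (hθ.differentiable (by simp)) t).symm
    · rw [inner_toL2, ← integral_const_mul]
      exact integral_congr_ae (Eventually.of_forall fun x => mul_left_comm _ _ _)
  · filter_upwards [hae, hpos] with t ht h0
    simp only [hGF _ t h0]
    exact ht.2.2

/-! ### Scalar lemmas -/

/-- A closed condition that holds for almost every `t ≥ 0` holds for every `t ≥ 0`. -/
theorem forall_of_ae_timeMeasure {P : ℝ → Prop} (hP : IsClosed {t | P t})
    (h : ∀ᵐ t ∂timeMeasure, P t) {t : ℝ} (ht : 0 ≤ t) : P t := by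
  have hU : IsOpen ({t | P t}ᶜ ∩ Ioi (0 : ℝ)) := hP.isOpen_compl.inter isOpen_Ioi
  have h0 : volume ({t | P t}ᶜ ∩ Ioi (0 : ℝ)) = 0 := by
    rw [timeMeasure, ae_restrict_iff' measurableSet_Ici] at h
    refine measure_mono_null ?_ h
    rintro s ⟨hs, hs0⟩ hc
    exact hs (hc (mem_Ici.2 (le_of_lt (mem_Ioi.1 hs0))))
  rw [hU.measure_eq_zero_iff volume] at h0
  have hsub : Ioi (0 : ℝ) ⊆ {t | P t} := by
    intro s hs
    by_contra hc
    exact (h0 ▸ (⟨hc, hs⟩ : s ∈ {t | P t}ᶜ ∩ Ioi (0 : ℝ)) : s ∈ (∅ : Set ℝ))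
  have := closure_minimal hsub hP
  rw [closure_Ioi] at this
  exact this ht

/-- Integral form of Gronwall's inequality with damping. -/
theorem le_exp_of_integral_le {y : ℝ → ℝ} {β K : ℝ} (hβ : 0 < β) (hy : Continuous y)
    (h : ∀ s t, 0 ≤ s → s ≤ t → y t + β * ∫ r in s..t, y r ≤ y s + K * (t - s))
    {t : ℝ} (ht : 0 ≤ t) :
    y t ≤ y 0 * Real.exp (-β * t) + K / β * (1 - Real.exp (-β * t)) := by
  -- Differentiability of `y` is not required: the integral inequality bounds its right difference
  -- quotients by averages of `-βy + K`. Gronwall is applied with the negative rate `-β`.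
  have hg := le_gronwallBound_of_liminf_deriv_right_le (f := y) (f' := fun x => -β * y x + K)
    (δ := y 0) (K := -β) (ε := K) (a := 0) (b := t) hy.continuousOn ?_ le_rfl
    (fun x _ => le_rfl) t ⟨ht, le_rfl⟩
  · rw [gronwallBound_of_K_ne_0 (neg_ne_zero.2 hβ.ne'), sub_zero] at hg
    refine hg.trans (le_of_eq ?_)
    rw [div_neg]; ring
  · intro x hx r hr
    have hd : HasDerivAt (fun z => ∫ s in x..z, (-β * y s + K)) (-β * y x + K) x :=
      intervalIntegral.integral_hasDerivAt_right
        (Continuous.intervalIntegrable (by fun_prop) _ _)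
        (Continuous.stronglyMeasurableAtFilter (by fun_prop) _ _) (by fun_prop)
    have hs := hasDerivWithinAt_iff_tendsto_slope' (s := Ioi x) (by simp) |>.1 hd.hasDerivWithinAt
    refine Eventually.frequently ?_
    filter_upwards [hs.eventually (gt_mem_nhds hr), self_mem_nhdsWithin] with z hz hxz
    refine lt_of_le_of_lt ?_ hz
    rw [slope_def_field, intervalIntegral.integral_same, sub_zero, inv_mul_eq_div]
    have hxz' : x < z := hxz
    refine div_le_div_of_nonneg_right ?_ (sub_pos.2 hxz').le
    rw [intervalIntegral.integral_add (Continuous.intervalIntegrable (by fun_prop) _ _)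
      (by simp), intervalIntegral.integral_const_mul, intervalIntegral.integral_const]
    have := h x z hx.1 hxz'.le
    simp only [smul_eq_mul]
    linarith

/-! ### Uniform `H¹` bounds pass to the continuous representative -/

/-- The bound makes `φ ↦ -⟨g, ∂ⱼφ⟩` continuous for the `L²` norm, and its Riesz representative is
the weak derivative. -/
theorem memSob_one_of_abs_inner_le {g : L2} {C : ℝ} (hC : 0 ≤ C)
    (h : ∀ j (φ : E3 → ℝ) (hφ : IsTest φ), |inner ℝ g (hφ.pd j).toL2| ≤ C * ‖hφ.toL2‖) :
    MemSob 1 g := by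
  have hex : ∀ j, ∃ d, HasWeakPartial j g d := by
    intro j
    obtain ⟨d, -, hd⟩ := exists_inner_eq_of_abs_le testToL2
      (-((innerSL ℝ g).toLinearMap ∘ₗ testToL2 ∘ₗ testPd j)) hC (by
        rintro ⟨φ, hφ⟩
        rw [LinearMap.neg_apply, abs_neg]
        exact h j φ hφ)
    refine ⟨d, hasWeakPartial_iff.2 fun φ hφ => ?_⟩
    have := hd ⟨φ, hφ⟩
    rw [LinearMap.neg_apply] at this
    change inner ℝ d hφ.toL2 = -inner ℝ g (hφ.pd j).toL2 at this
    linarith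
  choose d hd using hex
  exact memSob_one_of hd

/-! ### Measurability of derivatives in time -/

/-- The derivative is defined by choice, but its pairings with test functions are pairings of `g`
with their derivatives; weak measurability suffices in a separable space. -/
theorem aestronglyMeasurable_weakPartial {g : ℝ → L2} (hg : AEStronglyMeasurable g timeMeasure)
    (h1 : ∀ᵐ t ∂timeMeasure, MemSob 1 (g t)) (j : Fin 3) :
    AEStronglyMeasurable (fun t => weakPartial j (g t)) timeMeasure := by
  refine aestronglyMeasurable_of_inner dense_testSet ?_
  rintro _ ⟨φ, hφ, rfl⟩
  have hm : AEStronglyMeasurable (fun t => -inner ℝ (g t) (hφ.pd j).toL2) timeMeasure :=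
    (hg.inner aestronglyMeasurable_const).neg
  refine hm.congr ?_
  filter_upwards [h1] with t ht
  rw [hasWeakPartial_iff.1 (ht.hasWeakPartial j) φ hφ, neg_neg]

theorem intervalIntegrable_inner_prim {H : Type*} [NormedAddCommGroup H] [InnerProductSpace ℝ H]
    {G : ℝ → H} (hG : LocallyIntegrable G volume) (a : H) (s t : ℝ) :
    IntervalIntegrable (fun r => inner ℝ (G r) (prim a G r)) volume s t := by
  obtain ⟨C, hC⟩ := isCompact_uIcc.exists_bound_of_continuousOn
    (continuous_prim hG a).continuousOn (s := uIcc s t)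
  have hi := intervalIntegrable_of_locallyIntegrable hG s t
  refine (hi.norm.mul_const C).mono_fun' ?_ ?_
  · exact hi.aestronglyMeasurable_restrict_uIoc.inner
      (continuous_prim hG a).aestronglyMeasurable
  · filter_upwards [ae_restrict_mem measurableSet_uIoc] with r hr
    refine (norm_inner_le_norm _ _).trans ?_
    exact mul_le_mul_of_nonneg_left (hC r (uIoc_subset_uIcc hr)) (norm_nonneg _)

/-! ### The regularized energy -/

/-- The energy of the mollified function. -/
def smoothEnergy (α : ℝ) (n : ℕ) (g : L2) : ℝ :=
  ‖smooth n g‖ ^ 2 + α ^ 2 * ∑ j, ‖dsmooth n j g‖ ^ 2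

/-- The bilinear form polarizing `smoothEnergy`. -/
def smoothInner (α : ℝ) (n : ℕ) (g h : L2) : ℝ :=
  inner ℝ (smooth n g) (smooth n h) + α ^ 2 * ∑ j, inner ℝ (dsmooth n j g) (dsmooth n j h)

theorem intervalIntegrable_fun_sum {ι : Type*} [Fintype ι] {F : ι → ℝ → ℝ} {s t : ℝ}
    (h : ∀ i, IntervalIntegrable (F i) volume s t) :
    IntervalIntegrable (fun r => ∑ i, F i r) volume s t := by
  simpa only [Finset.sum_fn] using IntervalIntegrable.sum Finset.univ fun i _ => h i

theorem intervalIntegrable_smoothInner {G : ℝ → L2} (hG : LocallyIntegrable G volume) (a : L2)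
    (α : ℝ) (n : ℕ) (s t : ℝ) :
    IntervalIntegrable (fun r => smoothInner α n (G r) (prim a G r)) volume s t := by
  have h : ∀ B : L2 →L[ℝ] L2,
      IntervalIntegrable (fun r => inner ℝ (B (G r)) (B (prim a G r))) volume s t := fun B => by
    simp only [clm_prim hG B]
    exact intervalIntegrable_inner_prim (locallyIntegrable_clm hG B) _ s t
  refine (h (smooth n)).add (IntervalIntegrable.const_mul ?_ _)
  exact intervalIntegrable_fun_sum fun j => h (dsmooth n j)

/-- The operators `smooth n` and `dsmooth n j` are bounded on `L²`, so they commute with the time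
integral and the chain rule applies to each image curve, although `G` has no spatial derivative. -/
theorem smoothEnergy_prim_sub {G : ℝ → L2} (hG : LocallyIntegrable G volume) (a : L2)
    (α : ℝ) (n : ℕ) (s t : ℝ) :
    smoothEnergy α n (prim a G t) - smoothEnergy α n (prim a G s)
      = 2 * ∫ r in s..t, smoothInner α n (G r) (prim a G r) := by
  have hi : ∀ B : L2 →L[ℝ] L2,
      IntervalIntegrable (fun r => inner ℝ (B (G r)) (B (prim a G r))) volume s t := fun B => by
    simp only [clm_prim hG B]
    exact intervalIntegrable_inner_prim (locallyIntegrable_clm hG B) _ s t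
  have h : ∀ B : L2 →L[ℝ] L2, ‖B (prim a G t)‖ ^ 2 - ‖B (prim a G s)‖ ^ 2
      = 2 * ∫ r in s..t, inner ℝ (B (G r)) (B (prim a G r)) := fun B => by
    simp only [clm_prim hG B]
    exact norm_sq_prim_sub (locallyIntegrable_clm hG B) _ s t
  unfold smoothInner smoothEnergy
  rw [intervalIntegral.integral_add (hi (smooth n)) (IntervalIntegrable.const_mul
    (intervalIntegrable_fun_sum fun j => hi (dsmooth n j)) _), intervalIntegral.integral_const_mul,
    intervalIntegral.integral_finsetSum fun j _ => hi (dsmooth n j), mul_add, ← h, mul_left_comm,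
    Finset.mul_sum _ _ (2 : ℝ), Finset.sum_congr rfl fun j _ => (h (dsmooth n j)).symm,
    Finset.sum_sub_distrib]
  ring

theorem tendsto_smoothEnergy (α : ℝ) {g : L2} (hg : MemSob 1 g) :
    Tendsto (fun n => smoothEnergy α n g) atTop (𝓝 (‖g‖ ^ 2 + α ^ 2 * homSq 1 g)) := by
  unfold smoothEnergy
  simp only [(hg.hasWeakPartial _).dsmooth_eq]
  exact ((tendsto_smooth g).norm.pow 2).add
    ((tendsto_finsetSum _ fun j _ => (tendsto_smooth _).norm.pow 2).const_mul _)

/-- Integration by parts moves the derivative from the rough argument to the `H²` one, which gives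
bounds uniform in `n` and a limit. -/
theorem smoothInner_eq (α : ℝ) (n : ℕ) (g : L2) {h : L2} (hh : MemSob 2 h) :
    smoothInner α n g h = inner ℝ (smooth n g) (smooth n (h - α ^ 2 • lapL2 h)) := by
  have hj : ∀ j, inner ℝ (dsmooth n j g) (dsmooth n j h)
      = -inner ℝ (smooth n g) (smooth n (weakPartial j (weakPartial j h))) := by
    intro j
    rw [(hh.hasWeakPartial j).dsmooth_eq n]
    have := (hasWeakPartial_smooth n j g).inner_eq_neg
      (((hh.weakPartial j).hasWeakPartial j).smooth n)
    linarith
  rw [map_sub, map_smul, lapL2, map_sum, inner_sub_right, real_inner_smul_right, inner_sum,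
    smoothInner]
  simp only [hj, Finset.sum_neg_distrib]
  ring

theorem abs_smoothInner_le (α : ℝ) (n : ℕ) (g : L2) {h : L2} (hh : MemSob 2 h) :
    |smoothInner α n g h| ≤ ‖g‖ ^ 2 + ‖h - α ^ 2 • lapL2 h‖ ^ 2 := by
  rw [smoothInner_eq α n g hh]
  refine (abs_real_inner_le_norm _ _).trans ?_
  have h1 := norm_smooth_le n g
  have h2 := norm_smooth_le n (h - α ^ 2 • lapL2 h)
  have h3 := mul_le_mul h1 h2 (norm_nonneg _) (norm_nonneg _)
  nlinarith [sq_nonneg (‖g‖ - ‖h - α ^ 2 • lapL2 h‖), sq_nonneg ‖g‖,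
    sq_nonneg ‖h - α ^ 2 • lapL2 h‖]

theorem tendsto_smoothInner (α : ℝ) (g : L2) {h : L2} (hh : MemSob 2 h) :
    Tendsto (fun n => smoothInner α n g h) atTop (𝓝 (inner ℝ g (h - α ^ 2 • lapL2 h))) := by
  simp only [smoothInner_eq α _ g hh]
  exact (tendsto_smooth g).inner (tendsto_smooth _)

/-- Young's inequality `2ab ≤ βb² + a²/β`, applied termwise. The weight is chosen so that the force
consumes exactly half of the damping `2βE`. -/
theorem energyInner_le {α β : ℝ} (hβ : 0 < β) (f u : VL2) :
    2 * energyInner α f u ≤ β * energySq α u + energySq α f / β := by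
  have hc : ∀ a b : L2, 2 * inner ℝ a b ≤ β * ‖b‖ ^ 2 + ‖a‖ ^ 2 / β := by
    intro a b
    have h1 := real_inner_le_norm a b
    have h2 : 2 * (‖a‖ * ‖b‖) ≤ β * ‖b‖ ^ 2 + ‖a‖ ^ 2 / β := by
      have : β * ‖b‖ ^ 2 + ‖a‖ ^ 2 / β - 2 * (‖a‖ * ‖b‖) = (β * ‖b‖ - ‖a‖) ^ 2 / β := by
        field_simp; ring
      have h3 : 0 ≤ (β * ‖b‖ - ‖a‖) ^ 2 / β := by positivity
      linarith
    linarith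
  rw [← energyInner_self α u, ← energyInner_self α f]
  unfold energyInner
  rw [Finset.mul_sum, Finset.mul_sum, Finset.sum_div, ← Finset.sum_add_distrib]
  refine Finset.sum_le_sum fun i _ => ?_
  have h1 := hc (f i) (u i)
  have h2 : 2 * ∑ j, inner ℝ (weakPartial j (f i)) (weakPartial j (u i))
      ≤ β * ∑ j, inner ℝ (weakPartial j (u i)) (weakPartial j (u i))
        + (∑ j, inner ℝ (weakPartial j (f i)) (weakPartial j (f i))) / β := by
    rw [Finset.mul_sum, Finset.mul_sum, Finset.sum_div, ← Finset.sum_add_distrib]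
    refine Finset.sum_le_sum fun j _ => ?_
    simp only [real_inner_self_eq_norm_sq]
    exact hc _ _
  have h3 := mul_le_mul_of_nonneg_left h2 (sq_nonneg α)
  simp only [real_inner_self_eq_norm_sq] at h3 ⊢
  rw [add_div, mul_div_assoc]
  linarith

/-! ### Integrability on bounded time intervals -/

theorem ae_uIoc_of_ae_timeMeasure {P : ℝ → Prop} (h : ∀ᵐ t ∂timeMeasure, P t) {s t : ℝ}
    (hs : 0 ≤ s) (ht : 0 ≤ t) : ∀ᵐ r, r ∈ uIoc s t → P r := by
  rw [timeMeasure, ae_restrict_iff' measurableSet_Ici] at h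
  filter_upwards [h] with r hr hrst
  exact hr ((le_min hs ht).trans hrst.1.le)

theorem intervalIntegrable_of_integrableOn_Icc {g : ℝ → ℝ}
    (h : ∀ T : ℝ, IntegrableOn g (Icc 0 T)) {s t : ℝ} (hs : 0 ≤ s) (ht : 0 ≤ t) :
    IntervalIntegrable g volume s t :=
  intervalIntegrable_iff.2 ((h (max s t)).mono_set fun _ hr =>
    ⟨(le_min hs ht).trans hr.1.le, hr.2⟩)

theorem integrableOn_Icc_of_ae_le {g : ℝ → ℝ} {C : ℝ} (hg : AEStronglyMeasurable g timeMeasure)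
    (h : ∀ᵐ t ∂timeMeasure, |g t| ≤ C) (T : ℝ) : IntegrableOn g (Icc 0 T) :=
  Integrable.mono' (g := fun _ => C) (integrableOn_const (by simp))
    (hg.mono_measure (Measure.restrict_mono Icc_subset_Ici_self le_rfl))
    (ae_Icc_of_ae_timeMeasure h T)

theorem energySq_eq_sum (α : ℝ) (u : VL2) :
    energySq α u = ∑ i, (‖u i‖ ^ 2 + α ^ 2 * homSq 1 (u i)) := by
  rw [Finset.sum_add_distrib, ← Finset.mul_sum]
  rfl

theorem InEnergySpace.aestronglyMeasurable_apply {u : ℝ → VL2} (hu : InEnergySpace u)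
    (i : Fin 3) : AEStronglyMeasurable (fun t => u t i) timeMeasure :=
  (continuous_apply i).comp_aestronglyMeasurable hu.meas

theorem InEnergySpace.aestronglyMeasurable_weakPartial {u : ℝ → VL2} (hu : InEnergySpace u)
    (i j : Fin 3) : AEStronglyMeasurable (fun t => weakPartial j (u t i)) timeMeasure :=
  Bardina.aestronglyMeasurable_weakPartial (hu.aestronglyMeasurable_apply i)
    (hu.memH1.mono fun _ h => h i) j

theorem InEnergySpace.integrableOn_vhomSq_zero {u : ℝ → VL2} (hu : InEnergySpace u) (T : ℝ) :
    IntegrableOn (fun t => vhomSq 0 (u t)) (Icc 0 T) := by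
  obtain ⟨M, hM⟩ := hu.bound
  refine integrableOn_Icc_of_ae_le (C := M) ?_ ?_ T
  · exact Finset.aestronglyMeasurable_fun_sum _ fun i _ =>
      (hu.aestronglyMeasurable_apply i).norm.pow 2
  · filter_upwards [hM] with t ht
    rw [abs_of_nonneg (vhomSq_nonneg _ _)]
    linarith [vhomSq_nonneg 1 (u t)]

theorem InEnergySpace.integrableOn_vhomSq_one {u : ℝ → VL2} (hu : InEnergySpace u) (T : ℝ) :
    IntegrableOn (fun t => vhomSq 1 (u t)) (Icc 0 T) := by
  obtain ⟨M, hM⟩ := hu.bound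
  refine integrableOn_Icc_of_ae_le (C := M) ?_ ?_ T
  · exact Finset.aestronglyMeasurable_fun_sum _ fun i _ =>
      Finset.aestronglyMeasurable_fun_sum _ fun j _ =>
        (hu.aestronglyMeasurable_weakPartial i j).norm.pow 2
  · filter_upwards [hM] with t ht
    rw [abs_of_nonneg (vhomSq_nonneg _ _)]
    linarith [vhomSq_nonneg 0 (u t)]

theorem InEnergySpace.integrableOn_energySq {u : ℝ → VL2} (hu : InEnergySpace u) (α T : ℝ) :
    IntegrableOn (fun t => energySq α (u t)) (Icc 0 T) :=
  (hu.integrableOn_vhomSq_zero T).add ((hu.integrableOn_vhomSq_one T).const_mul _)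

theorem abs_two_mul_energyInner_le (α : ℝ) (f u : VL2) :
    |2 * energyInner α f u| ≤ energySq α u + energySq α f := by
  have hc : ∀ a b : L2, |2 * inner ℝ a b| ≤ ‖b‖ ^ 2 + ‖a‖ ^ 2 := by
    intro a b
    rw [abs_mul, abs_two]
    nlinarith [abs_real_inner_le_norm a b, sq_nonneg (‖a‖ - ‖b‖)]
  rw [energySq_eq_sum, energySq_eq_sum, ← Finset.sum_add_distrib, energyInner, Finset.mul_sum]
  refine (Finset.abs_sum_le_sum_abs _ _).trans (Finset.sum_le_sum fun i _ => ?_)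
  have h2 : |2 * ∑ j, inner ℝ (weakPartial j (f i)) (weakPartial j (u i))|
      ≤ homSq 1 (u i) + homSq 1 (f i) := by
    rw [homSq_one, homSq_one, ← Finset.sum_add_distrib, Finset.mul_sum]
    exact (Finset.abs_sum_le_sum_abs _ _).trans (Finset.sum_le_sum fun j _ => hc _ _)
  have h3 := mul_le_mul_of_nonneg_left h2 (sq_nonneg α)
  have h4 := hc (f i) (u i)
  rw [mul_add, mul_left_comm]
  refine (abs_add_le _ _).trans ?_
  rw [abs_mul (α ^ 2), abs_of_nonneg (sq_nonneg α)]
  linarith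

theorem InEnergySpace.integrableOn_energyInner {u : ℝ → VL2} (hu : InEnergySpace u) (α : ℝ)
    (f : VL2) (T : ℝ) : IntegrableOn (fun t => energyInner α f (u t)) (Icc 0 T) := by
  refine Integrable.mono' (g := fun t => energySq α (u t) + energySq α f)
    ((hu.integrableOn_energySq α T).add (integrableOn_const (by simp))) ?_
    (Eventually.of_forall fun t => ?_)
  · refine AEStronglyMeasurable.mono_measure ?_
      (Measure.restrict_mono Icc_subset_Ici_self le_rfl : _ ≤ timeMeasure)
    refine Finset.aestronglyMeasurable_fun_sum _ fun i _ =>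
      (aestronglyMeasurable_const.inner (hu.aestronglyMeasurable_apply i)).add
        (AEStronglyMeasurable.const_mul ?_ _)
    exact Finset.aestronglyMeasurable_fun_sum _ fun j _ =>
      aestronglyMeasurable_const.inner (hu.aestronglyMeasurable_weakPartial i j)
  · have := abs_two_mul_energyInner_le α f (u t)
    rw [abs_mul, abs_two] at this
    rw [Real.norm_eq_abs]
    linarith [abs_nonneg (energyInner α f (u t))]

/-! ### The energy balance -/

/-- A continuous version of a function in the energy space takes values in `H¹` at every time. -/
theorem InEnergySpace.memSob_one_of_continuous {u : ℝ → VL2} (hu : InEnergySpace u)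
    {v : ℝ → VL2} (hv : Continuous v) (hvu : ∀ᵐ t ∂timeMeasure, v t = u t) {t : ℝ} (ht : 0 ≤ t)
    (i : Fin 3) : MemSob 1 (v t i) := by
  obtain ⟨M, hM⟩ := hu.bound
  refine memSob_one_of_abs_inner_le (C := 1 + |M|) (by positivity) fun j φ hφ => ?_
  -- For each test function the derivative bound is a closed condition on `t`, so it passes from
  -- almost every time to every time by `L²` continuity.
  refine forall_of_ae_timeMeasure
    (P := fun t => |inner ℝ (v t i) (hφ.pd j).toL2| ≤ (1 + |M|) * ‖hφ.toL2‖) ?_ ?_ ht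
  · exact isClosed_le (((continuous_apply i).comp hv).inner continuous_const).abs
      continuous_const
  · filter_upwards [hM, hvu, hu.memH1] with r hr hvr h1
    rw [hvr, hasWeakPartial_iff.1 ((h1 i).hasWeakPartial j) φ hφ, abs_neg]
    refine (abs_real_inner_le_norm _ _).trans (mul_le_mul_of_nonneg_right ?_ (norm_nonneg _))
    have h3 : ‖weakPartial j (u r i)‖ ^ 2 ≤ homSq 1 (u r i) := by
      rw [homSq_one]
      exact Finset.single_le_sum (f := fun j => ‖weakPartial j (u r i)‖ ^ 2)
        (fun _ _ => sq_nonneg _) (Finset.mem_univ j)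
    have h4 := homSq_le_vhomSq 1 (u r) i
    have h5 := vhomSq_nonneg 0 (u r)
    nlinarith [le_abs_self M, sq_nonneg (‖weakPartial j (u r i)‖ - 1), abs_nonneg M]

theorem isDivFree_of_continuous {u v : ℝ → VL2} (hu : ∀ᵐ t ∂timeMeasure, IsDivFree (u t))
    (hv : Continuous v) (hvu : ∀ᵐ t ∂timeMeasure, v t = u t) {t : ℝ} (ht : 0 ≤ t) :
    IsDivFree (v t) := by
  refine isDivFree_iff.2 fun φ hφ => ?_
  refine forall_of_ae_timeMeasure
    (P := fun t => ∑ i, inner ℝ (v t i) (hφ.pd i).toL2 = 0) ?_ ?_ ht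
  · exact isClosed_eq (continuous_finsetSum _ fun i _ =>
      ((continuous_apply i).comp hv).inner continuous_const) continuous_const
  · filter_upwards [hu, hvu] with r hr hvr
    rw [hvr]
    exact isDivFree_iff.1 hr φ hφ

theorem norm_sub_smul_lapL2_sq_le (α : ℝ) {g : L2} (hg : MemSob 2 g) :
    ‖g - α ^ 2 • lapL2 g‖ ^ 2 ≤ 2 * ‖g‖ ^ 2 + 2 * α ^ 4 * homSq 2 g := by
  have h1 := norm_sub_le g (α ^ 2 • lapL2 g)
  rw [norm_smul, Real.norm_of_nonneg (sq_nonneg α)] at h1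
  have h2 := pow_le_pow_left₀ (norm_nonneg _) h1 2
  rw [← norm_lapL2_sq hg]
  nlinarith [sq_nonneg (‖g‖ - α ^ 2 * ‖lapL2 g‖)]

/-- The increments of the energy of an absolutely continuous curve in the energy space. -/
theorem InEnergySpace.energySq_prim_sub {u : ℝ → VL2} (hu : InEnergySpace u) {u₀ : VL2} (α : ℝ)
    {G : Fin 3 → ℝ → L2} (hG : ∀ i, LocallyIntegrable (G i) volume)
    (hG2 : ∀ i T, IntegrableOn (fun t => ‖G i t‖ ^ 2) (Icc 0 T))
    (hGu : ∀ᵐ t ∂timeMeasure, ∀ i, prim (u₀ i) (G i) t = u t i)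
    (h1 : ∀ t, 0 ≤ t → ∀ i, MemSob 1 (prim (u₀ i) (G i) t))
    {s t : ℝ} (hs : 0 ≤ s) (ht : 0 ≤ t) :
    energySq α (fun i => prim (u₀ i) (G i) t) - energySq α (fun i => prim (u₀ i) (G i) s)
      = 2 * ∫ r in s..t, ∑ i, inner ℝ (G i r) (u r i - α ^ 2 • lapL2 (u r i)) := by
  have hE : ∀ t, 0 ≤ t → Tendsto (fun n => ∑ i, smoothEnergy α n (prim (u₀ i) (G i) t)) atTop
      (𝓝 (energySq α fun i => prim (u₀ i) (G i) t)) := fun t ht => by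
    rw [energySq_eq_sum]
    exact tendsto_finsetSum _ fun i _ => tendsto_smoothEnergy α (h1 t ht i)
  have hI : ∀ n, IntervalIntegrable
      (fun r => ∑ i, smoothInner α n (G i r) (prim (u₀ i) (G i) r)) volume s t := fun n =>
    intervalIntegrable_fun_sum fun i => intervalIntegrable_smoothInner (hG i) _ α n s t
  have hn : ∀ n, ∑ i, smoothEnergy α n (prim (u₀ i) (G i) t)
      - ∑ i, smoothEnergy α n (prim (u₀ i) (G i) s)
      = 2 * ∫ r in s..t, ∑ i, smoothInner α n (G i r) (prim (u₀ i) (G i) r) := fun n => by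
    rw [intervalIntegral.integral_finsetSum fun i _ =>
      intervalIntegrable_smoothInner (hG i) _ α n s t, Finset.mul_sum, ← Finset.sum_sub_distrib]
    exact Finset.sum_congr rfl fun i _ => smoothEnergy_prim_sub (hG i) _ α n s t
  refine tendsto_nhds_unique ((hE t ht).sub (hE s hs)) ?_
  simp only [hn]
  refine Tendsto.const_mul 2 ?_
  have hae := ae_uIoc_of_ae_timeMeasure (hGu.and hu.memH2) hs ht
  -- Mollification does not increase `L²` norms, so `‖G‖² + ‖u - α²Δu‖²` dominates independently of
  -- `n`; it is integrable since `G` is square integrable in time and `u ∈ L²_loc(H²)`.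
  refine intervalIntegral.tendsto_integral_filter_of_dominated_convergence
    (fun r => (∑ i, ‖G i r‖ ^ 2) + (2 * vhomSq 0 (u r) + 2 * α ^ 4 * vhomSq 2 (u r)))
    (Eventually.of_forall fun n => (hI n).aestronglyMeasurable_restrict_uIoc)
    (Eventually.of_forall fun n => ?_) ?_ ?_
  · filter_upwards [hae] with r hr hrst
    obtain ⟨hr1, hr2⟩ := hr hrst
    simp only [hr1]
    refine (norm_sum_le _ _).trans ?_
    simp only [vhomSq, Finset.mul_sum, ← Finset.sum_add_distrib]
    refine Finset.sum_le_sum fun i _ => ?_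
    rw [Real.norm_eq_abs]
    refine (abs_smoothInner_le α n _ (hr2 i)).trans ?_
    have := norm_sub_smul_lapL2_sq_le α (hr2 i)
    have h0 : homSq 0 (u r i) = ‖u r i‖ ^ 2 := rfl
    rw [h0]
    linarith
  · refine (intervalIntegrable_fun_sum fun i =>
      intervalIntegrable_of_integrableOn_Icc (hG2 i) hs ht).add
      (((intervalIntegrable_of_integrableOn_Icc hu.integrableOn_vhomSq_zero hs ht).const_mul
        2).add ((intervalIntegrable_of_integrableOn_Icc hu.sqInt hs ht).const_mul _))
  · filter_upwards [hae] with r hr hrst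
    obtain ⟨hr1, hr2⟩ := hr hrst
    simp only [hr1]
    exact tendsto_finsetSum _ fun i _ => tendsto_smoothInner α _ (hr2 i)

/-- A weak solution has a continuous version which satisfies the energy balance. -/
theorem IsWeakSolution.exists_energy_balance {ν α β : ℝ} (hα : 0 < α) {u₀ f : VL2}
    (hf : ∀ i, MemSob 1 (f i)) {u : ℝ → VL2} {p : ℝ → L2}
    (hup : IsWeakSolution ν α β f u₀ u p) :
    ∃ v : ℝ → VL2, Continuous v ∧ (∀ᵐ t ∂timeMeasure, v t = u t) ∧ v 0 = u₀ ∧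
      (∀ t, 0 ≤ t → MemSolenoidalH1 (v t)) ∧
      ∀ s t, 0 ≤ s → 0 ≤ t → energySq α (v t) - energySq α (v s)
        = 2 * ∫ r in s..t, (-ν * (vhomSq 1 (u r) + α ^ 2 * vhomSq 2 (u r))
            - β * energySq α (u r) + energyInner α f (u r)) := by
  obtain ⟨G, hG, hG2, hGu, hpow⟩ := hup.exists_evolution hα hf
  have hc : Continuous fun t i => prim (u₀ i) (G i) t :=
    continuous_pi fun i => continuous_prim (hG i) _
  have hvu : ∀ᵐ t ∂timeMeasure, (fun i => prim (u₀ i) (G i) t) = u t :=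
    hGu.mono fun t ht => funext ht
  have h1 : ∀ t, 0 ≤ t → ∀ i, MemSob 1 (prim (u₀ i) (G i) t) := fun t ht i =>
    hup.energySpace.memSob_one_of_continuous hc hvu ht i
  refine ⟨fun t i => prim (u₀ i) (G i) t, hc, hvu, funext fun i => prim_zero _ _,
    fun t ht => ⟨h1 t ht, isDivFree_of_continuous hup.divFree hc hvu ht⟩, fun s t hs ht => ?_⟩
  rw [hup.energySpace.energySq_prim_sub α hG hG2 hGu h1 hs ht]
  congr 1
  exact intervalIntegral.integral_congr_ae (ae_uIoc_of_ae_timeMeasure hpow hs ht)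

end Bardina

end

/-! ### The two energy estimates -/

theorem mainTheorem2 (ν α β : ℝ) (hν : 0 < ν) (hα : 0 < α) (hβ : 0 < β)
    (u₀ f : Bardina.VL2)
    (hu₀ : Bardina.MemSolenoidalH1 u₀) (hf : Bardina.MemSolenoidalH1 f)
    (u : ℝ → Bardina.VL2) (p : ℝ → Bardina.L2)
    (hup : Bardina.IsWeakSolution ν α β f u₀ u p) :
    ∃ v : ℝ → Bardina.VL2,
      Bardina.IsContinuousVersion u v ∧ v 0 = u₀ ∧
      (∀ t : ℝ, 0 ≤ t →
        Bardina.MemSolenoidalH1 (v t) ∧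
        Bardina.energySq α (v t) ≤
          Bardina.energySq α u₀ * Real.exp (-β * t)
            + 4 / β ^ 2 * Bardina.energySq α f) ∧
      (∀ t T : ℝ, 0 ≤ t → 0 ≤ T →
        IntervalIntegrable (fun s => Bardina.vhomSq 1 (v s)) volume t (t + T) ∧
        IntervalIntegrable (fun s => Bardina.vhomSq 2 (v s)) volume t (t + T) ∧
        ν * (∫ s in t..(t + T), Bardina.vhomSq 1 (v s))
            + ν * α ^ 2 * (∫ s in t..(t + T), Bardina.vhomSq 2 (v s)) ≤
          2 * T / β * Bardina.energySq α f + Bardina.energySq α (v t) ∧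
        (1 / 2 ≤ ν →
          ν * (∫ s in t..(t + T), Bardina.vhomSq 1 (v s))
              + α ^ 2 * (∫ s in t..(t + T), Bardina.vhomSq 2 (v s)) ≤
            2 * T / β * Bardina.energySq α f + Bardina.energySq α (v t))) := by
  obtain ⟨v, hvc, hvu, hv0, hvH, hbal⟩ := hup.exists_energy_balance hα hf.1
  have hu := hup.energySpace
  have hF := Bardina.energySq_nonneg α f
  have iI : ∀ {g : ℝ → ℝ}, (∀ T : ℝ, IntegrableOn g (Icc 0 T)) → ∀ {s t : ℝ}, 0 ≤ s → 0 ≤ t →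
      IntervalIntegrable g volume s t := fun h _ _ hs ht =>
    Bardina.intervalIntegrable_of_integrableOn_Icc h hs ht
  have hdiss : ∀ T : ℝ, IntegrableOn
      (fun r => Bardina.vhomSq 1 (u r) + α ^ 2 * Bardina.vhomSq 2 (u r)) (Icc 0 T) := fun T =>
    (hu.integrableOn_vhomSq_one T).add ((hu.sqInt T).const_mul _)
  have hpow : ∀ T : ℝ, IntegrableOn
      (fun r => -ν * (Bardina.vhomSq 1 (u r) + α ^ 2 * Bardina.vhomSq 2 (u r))
        - β * Bardina.energySq α (u r) + Bardina.energyInner α f (u r)) (Icc 0 T) := fun T =>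
    (((hdiss T).const_mul _).sub ((hu.integrableOn_energySq α T).const_mul _)).add
      (hu.integrableOn_energyInner α f T)
  -- The integrated form of `E' + βE + 2νD ≤ ‖f‖²/β`, from which both estimates follow.
  have hmain : ∀ s t : ℝ, 0 ≤ s → s ≤ t →
      Bardina.energySq α (v t) + β * (∫ r in s..t, Bardina.energySq α (u r))
        + 2 * ν * (∫ r in s..t, (Bardina.vhomSq 1 (u r) + α ^ 2 * Bardina.vhomSq 2 (u r)))
      ≤ Bardina.energySq α (v s) + Bardina.energySq α f / β * (t - s) := by
    intro s t hs hst
    have ht := hs.trans hst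
    have hD := iI hdiss hs ht
    have hE := iI (hu.integrableOn_energySq α) hs ht
    have hb := hbal s t hs ht
    have hle := intervalIntegral.integral_mono_on hst ((iI hpow hs ht).const_mul 2)
      (((hD.const_mul (-(2 * ν))).sub (hE.const_mul β)).add
        (intervalIntegrable_const (c := Bardina.energySq α f / β))) (fun r _ => by
          have := Bardina.energyInner_le (α := α) hβ f (u r)
          linarith)
    rw [intervalIntegral.integral_add ((hD.const_mul _).sub (hE.const_mul β))
      intervalIntegrable_const, intervalIntegral.integral_sub (hD.const_mul _) (hE.const_mul β),
      intervalIntegral.integral_const_mul, intervalIntegral.integral_const_mul,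
      intervalIntegral.integral_const_mul, intervalIntegral.integral_const, smul_eq_mul] at hle
    linarith
  have hcongr : ∀ (F : Bardina.VL2 → ℝ) {s t : ℝ}, 0 ≤ s → 0 ≤ t →
      ∀ᵐ r, r ∈ uIoc s t → F (u r) = F (v r) := fun F s t hs ht =>
    Bardina.ae_uIoc_of_ae_timeMeasure (hvu.mono fun r hr => by rw [hr]) hs ht
  refine ⟨v, ⟨hvc.continuousOn, hvu⟩, hv0, fun t ht => ⟨hvH t ht, ?_⟩, fun t T ht hT => ?_⟩
  · have hloc := Bardina.locallyIntegrable_indicator_Ici hpow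
    set P := (Ici (0 : ℝ)).indicator (fun r =>
      -ν * (Bardina.vhomSq 1 (u r) + α ^ 2 * Bardina.vhomSq 2 (u r))
        - β * Bardina.energySq α (u r) + Bardina.energyInner α f (u r)) with hP
    -- Continuity of `v` in `L²` says nothing about its `H¹` norm; time continuity of the energy
    -- comes from its expression as a primitive.
    have hyv : ∀ t : ℝ, 0 ≤ t →
        Bardina.energySq α (v 0) + 2 * (∫ r in (0 : ℝ)..t, P r) = Bardina.energySq α (v t) := by
      intro t ht
      have h1 : ∫ r in (0 : ℝ)..t, P r = ∫ r in (0 : ℝ)..t,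
          (-ν * (Bardina.vhomSq 1 (u r) + α ^ 2 * Bardina.vhomSq 2 (u r))
            - β * Bardina.energySq α (u r) + Bardina.energyInner α f (u r)) :=
        intervalIntegral.integral_congr fun r hr => by
          rw [uIcc_of_le ht] at hr
          exact indicator_of_mem (mem_Ici.2 hr.1) _
      rw [h1, ← hbal 0 t le_rfl ht]
      ring
    have hyc : Continuous fun t => Bardina.energySq α (v 0) + 2 * ∫ r in (0 : ℝ)..t, P r :=
      continuous_const.add (continuous_const.mul (intervalIntegral.continuous_primitive
        (Bardina.intervalIntegrable_of_locallyIntegrable hloc) 0))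
    have hgr := Bardina.le_exp_of_integral_le hβ hyc (K := Bardina.energySq α f / β) (by
      intro s t hs hst
      have ht := hs.trans hst
      have h1 : ∫ r in s..t, (Bardina.energySq α (v 0) + 2 * ∫ r in (0 : ℝ)..r, P r)
          = ∫ r in s..t, Bardina.energySq α (u r) := by
        refine intervalIntegral.integral_congr_ae ?_
        filter_upwards [hcongr (Bardina.energySq α) hs ht] with r hr hrst
        rw [hyv r (hs.trans (by rw [uIoc_of_le hst] at hrst; exact hrst.1.le)), hr hrst]
      rw [h1, hyv s hs, hyv t ht]
      have h2 := hmain s t hs hst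
      have h3 : 0 ≤ ∫ r in s..t, (Bardina.vhomSq 1 (u r) + α ^ 2 * Bardina.vhomSq 2 (u r)) :=
        intervalIntegral.integral_nonneg hst fun r _ => add_nonneg (Bardina.vhomSq_nonneg _ _)
          (mul_nonneg (sq_nonneg _) (Bardina.vhomSq_nonneg _ _))
      have h4 := mul_nonneg (mul_nonneg zero_le_two hν.le) h3
      linarith) ht
    rw [hyv t ht, hyv 0 le_rfl, hv0] at hgr
    have h5 : Bardina.energySq α f / β / β = Bardina.energySq α f / β ^ 2 := by
      rw [div_div, sq]
    have h6 : 0 ≤ Bardina.energySq α f / β ^ 2 := by positivity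
    have h7 : 4 / β ^ 2 * Bardina.energySq α f = 4 * (Bardina.energySq α f / β ^ 2) := by ring
    rw [h5] at hgr
    rw [h7]
    -- Gronwall gives the constant `1/β²`, which is weakened to `4/β²`.
    nlinarith [mul_nonneg h6 (Real.exp_pos (-β * t)).le]
  · have htT : 0 ≤ t + T := add_nonneg ht hT
    have hle : t ≤ t + T := le_add_of_nonneg_right hT
    have i1 := iI hu.integrableOn_vhomSq_one ht htT
    have i2 := iI hu.sqInt ht htT
    have c1 := hcongr (Bardina.vhomSq 1) ht htT
    have c2 := hcongr (Bardina.vhomSq 2) ht htT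
    have hm := hmain t (t + T) ht hle
    rw [intervalIntegral.integral_add i1 (i2.const_mul _), intervalIntegral.integral_const_mul,
      intervalIntegral.integral_congr_ae c1, intervalIntegral.integral_congr_ae c2] at hm
    have n1 : 0 ≤ ∫ s in t..(t + T), Bardina.vhomSq 1 (v s) :=
      intervalIntegral.integral_nonneg hle fun r _ => Bardina.vhomSq_nonneg _ _
    have n2 : 0 ≤ ∫ s in t..(t + T), Bardina.vhomSq 2 (v s) :=
      intervalIntegral.integral_nonneg hle fun r _ => Bardina.vhomSq_nonneg _ _
    have nE : 0 ≤ β * ∫ r in t..(t + T), Bardina.energySq α (u r) :=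
      mul_nonneg hβ.le (intervalIntegral.integral_nonneg hle fun r _ =>
        Bardina.energySq_nonneg _ _)
    have nv := Bardina.energySq_nonneg α (v (t + T))
    have nF : 0 ≤ Bardina.energySq α f / β * T := by positivity
    have eF : 2 * T / β * Bardina.energySq α f = 2 * (Bardina.energySq α f / β * T) := by ring
    rw [add_sub_cancel_left] at hm
    refine ⟨i1.congr_ae ((ae_restrict_iff' measurableSet_uIoc).2 c1),
      i2.congr_ae ((ae_restrict_iff' measurableSet_uIoc).2 c2), ?_, fun hν2 => ?_⟩
    · rw [eF]
      -- The integrated inequality carries `2ν` before the dissipation and `T/β` before the force, a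
      -- factor of two to spare on each side.
      nlinarith [mul_nonneg hν.le n1, mul_nonneg hν.le (mul_nonneg (sq_nonneg α) n2)]
    · rw [eF]
      -- Here that spare factor is used as `2ν ≥ 1`, so `2να²` dominates `α²`.
      nlinarith [mul_nonneg hν.le n1,
        mul_nonneg (sub_nonneg.2 hν2) (mul_nonneg (sq_nonneg α) n2)]
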